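/- Let $G$ be a profinite group, $q$ an integer and $A$ a special $\lambda$-ring with Adams operations $\Psi^n$. For a profinite group $H$ let $\mathcal O(H)$ be the set of conjugacy classes $[U]$ of open subgroups of $H$, ordered by $[V]\preceq[U]$ iff $U$ is contained in a conjugate of $V$; let $\varphi_V(H/W)$ be the number of $V$-fixed points of $H/W$, and $(W:V)=(H:V)/(H:W)$. Define matrices indexed by $\mathcal O(H)$ by $\zeta^q_H([V],[W])=\varphi_V(H/W)q^{(W:V)-1}$ and $\tilde\zeta^q_H([V],[W])=\varphi_V(H/W)q^{(W:V)-1}\Psi^{(W:V)}$ if $[W]\preceq[V]$, and $0$ otherwise, and let $\mu^q_H$ be the inverse of $\zeta^q_H$ over $\mathbb Q[q]$ ($q$ being regarded as an indeterminate). Let $Nr_H^q(A)=A^{\mathcal O(H)}$ with componentwise addition and with the multiplication $$(\mathbf x\cdot\mathbf y)([U])=\sum_{[V],[W]\preceq[U]}P^U_{V,W}(q)\,\Psi^{(V:U)}(\mathbf x([V]))\,\Psi^{(W:U)}(\mathbf y([W])),$$ $$P^U_{V,W}(q)=\sum_{[V],[W]\preceq[Z]\preceq[U]}\mu^q_H([U],[Z])\,\varphi_Z(H/V)\,\varphi_Z(H/W)\,q^{(V:Z)-1}q^{(W:Z)-1},$$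 and let $\tilde\varphi^q:Nr^q_H(A)\to A^{\mathcal O(H)}$, $\mathbf x\mapsto\tilde\zeta^q_H\mathbf x$, with $[U]$-component $\tilde\varphi^q_U$. For an embedding $f:H\to K$ of profinite groups with open image, let $\mathrm{Ind}_f:Nr^q_H(A)\to Nr^q_K(A)$ and $q\text{-Res}_f:Nr^q_K(A)\to Nr^q_H(A)$ be $$\mathrm{Ind}_f(\mathbf x)([W])=\sum_{[V]\in\mathcal O(H),\ [f(V)]=[W]}\mathbf x([V]),\qquad q\text{-Res}_f(\mathbf x)([V])=\sum_{[W]\preceq[f(V)]}Q_{V,W}(q)\,\Psi^{(W:f(V))}(\mathbf x([W])),$$ $$Q_{V,W}(q)=\sum_{[S]\in\mathcal O(H),\ [W]\preceq[f(S)],\ [S]\preceq[V]}\mu^q_H([V],[S])\,\varphi_{f(S)}(K/W)\,q^{(W:f(S))-1}.$$ Write $\mathrm{Ind}_U^V$, $q\text{-Res}_U^V$ when $f$ is an inclusion $U\subseteq V$, and $q\text{-Res}_U^V(g)$ when $g^{-1}Ug\subseteq V$ and $f$ is $u\mapsto g^{-1}ug$. Then all the values $P^U_{V,W}(q)$ (for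 $G$) and $Q_{V,W}(q)$ (for every open embedding of a profinite group into $G$) are integers, so that the definitions above make sense, and the following hold for all open subgroups $U,V$ of $G$. (a) (Frobenius reciprocity) For $\mathbf x\in Nr^q_G(A)$ and $\mathbf y\in Nr^q_U(A)$, $$\mathrm{Ind}_U^G(\mathbf y)\cdot\mathbf x=\mathrm{Ind}_U^G(\mathbf y\cdot q\text{-Res}_U^G(\mathbf x)).$$ (b) (Mackey subgroup theorem) As maps $Nr^q_V(A)\to Nr^q_U(A)$, $$q\text{-Res}_U^G\circ\mathrm{Ind}_V^G=\sum_{UgV\subseteq G}\mathrm{Ind}_{U\cap gVg^{-1}}^U\circ q\text{-Res}^V_{U\cap gVg^{-1}}(g),$$ the sum being over any system of representatives of the double cosets $UgV$. (c) As maps $Nr^q_V(A)\to A$, $$\tilde\varphi^q_U\circ\mathrm{Ind}_V^G=\sum_{gV\in(G/V)^U}\tilde\varphi^q_U\circ q\text{-Res}_U^V(g),$$ the sum being over any system of representatives $g$ of the $U$-fixed cosets; here $\tilde\varphi^q_U$ on the left is the $[U]$-component on $Nr^q_G(A)$ and on the right the $[U]$-component on $Nr^q_U(A)$. -/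

import Mathlib

/-! ## Special lambda-rings and Adams operations -/

/-- A special `λ`-ring: operations `λ^n` with `λ^0 = 1`, `λ^1 = id`,
`λ^n (a + b) = ∑ λ^i a * λ^(n-i) b`, `λ^n 1 = 0` for `n ≥ 2`, and
`λ^n (a * b) = P_n (λ a; λ b)`, `λ^m (λ^n a) = P_{m,n} (λ a)`, where `P_n` and `P_{m,n}` are the
universal integral polynomials: in terms of elementary symmetric functions of `N` variables
(`N` large enough), `P_n (e(x); e(y))` is the `n`-th elementary symmetric function of all products
`x i * y j`, and `P_{m,n} (e(x))` is the `m`-th elementary symmetric function of the products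
of the `x i` over the `n`-element subsets. The variable of index `i : Fin N` stands for
the elementary symmetric function of degree `i + 1`. -/
class SpecialLambdaRing (A : Type*) [CommRing A] where
  lam : ℕ → A → A
  lam_zero : ∀ a, lam 0 a = 1
  lam_one : ∀ a, lam 1 a = a
  lam_add : ∀ n a b, lam n (a + b) = ∑ i ∈ Finset.range (n + 1), lam i a * lam (n - i) b
  lam_unit : ∀ n, 2 ≤ n → lam n 1 = 0
  lam_mul : ∀ (n N : ℕ), n ≤ N → ∀ P : MvPolynomial (Fin N ⊕ Fin N) ℤ,
    MvPolynomial.aeval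
      (Sum.elim
        (fun i : Fin N => MvPolynomial.rename (Sum.inl : Fin N → Fin N ⊕ Fin N)
          (MvPolynomial.esymm (Fin N) ℤ (i + 1)))
        (fun j : Fin N => MvPolynomial.rename (Sum.inr : Fin N → Fin N ⊕ Fin N)
          (MvPolynomial.esymm (Fin N) ℤ (j + 1)))) P
      = ((Finset.univ : Finset (Fin N × Fin N)).val.map fun p =>
          (MvPolynomial.X (Sum.inl p.1) * MvPolynomial.X (Sum.inr p.2) :
            MvPolynomial (Fin N ⊕ Fin N) ℤ)).esymm n →
    ∀ a b, lam n (a * b) =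
      MvPolynomial.aeval
        (Sum.elim (fun i : Fin N => lam (i + 1) a) (fun j : Fin N => lam (j + 1) b)) P
  lam_lam : ∀ (m n N : ℕ), m * n ≤ N → ∀ P : MvPolynomial (Fin N) ℤ,
    MvPolynomial.aeval (fun i : Fin N => MvPolynomial.esymm (Fin N) ℤ (i + 1)) P
      = ((Finset.powersetCard n (Finset.univ : Finset (Fin N))).val.map fun S =>
          (∏ i ∈ S, MvPolynomial.X i : MvPolynomial (Fin N) ℤ)).esymm m →
    ∀ a, lam m (lam n a) = MvPolynomial.aeval (fun i : Fin N => lam (i + 1) a) P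

/-- The power series `λ_t(a) = ∑ λ^n(a) t^n`. -/
noncomputable def lamSeries {A : Type*} [CommRing A] [SpecialLambdaRing A] (a : A) :
    PowerSeries A :=
  PowerSeries.mk fun n => SpecialLambdaRing.lam n a

/-- The Adams operations `Ψ^n`, `n ≥ 1`, given by
`d/dt log λ_t(a) = λ_t'(a) / λ_t(a) = ∑_{n ≥ 0} (-1)^n Ψ^(n+1)(a) t^n`. -/
noncomputable def adams {A : Type*} [CommRing A] [SpecialLambdaRing A] (n : ℕ) (a : A) : A :=
  (-1) ^ (n - 1) * PowerSeries.coeff (n - 1)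
    (PowerSeries.derivative A (lamSeries a) * PowerSeries.invOfUnit (lamSeries a) 1)

/-! ## Conjugacy classes of open subgroups -/

theorem mk_mem_fixedPoints_iff {G : Type*} [Group G] [TopologicalSpace G]
    {V W : OpenSubgroup G} {a : G} :
    (a : G ⧸ (W : Subgroup G)) ∈ MulAction.fixedPoints V (G ⧸ (W : Subgroup G)) ↔
      ∀ v ∈ V, a⁻¹ * v * a ∈ W := by
  rw [MulAction.mem_fixedPoints]
  constructor
  · intro h v hv
    have h1 : ((v * a : G) : G ⧸ (W : Subgroup G)) = (a : G ⧸ (W : Subgroup G)) := h ⟨v, hv⟩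
    have h2 := QuotientGroup.eq.1 h1.symm
    rw [mul_assoc]
    exact h2
  · rintro h ⟨v, hv⟩
    change ((v * a : G) : G ⧸ (W : Subgroup G)) = (a : G ⧸ (W : Subgroup G))
    refine (QuotientGroup.eq.2 ?_).symm
    rw [← mul_assoc]
    exact h v hv

section Classes

variable {G : Type*} [Group G] [TopologicalSpace G] [IsTopologicalGroup G]

/-- The conjugate `g V g⁻¹`. -/
def conjOpen (g : G) (V : OpenSubgroup G) : OpenSubgroup G :=
  V.comap (MulAut.conj g⁻¹).toMonoidHom (by
    have : Continuous fun x : G => g⁻¹ * x * g := by fun_prop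
    refine this.congr fun x => ?_
    simp)

theorem mem_conjOpen {g : G} {V : OpenSubgroup G} {x : G} :
    x ∈ conjOpen g V ↔ g⁻¹ * x * g ∈ V := by
  simp [conjOpen]

theorem conjOpen_one (V : OpenSubgroup G) : conjOpen 1 V = V := by
  ext x; simp [mem_conjOpen]

theorem conjOpen_conjOpen (g h : G) (V : OpenSubgroup G) :
    conjOpen g (conjOpen h V) = conjOpen (g * h) V := by
  ext x; simp [mem_conjOpen, mul_assoc]

/-- Conjugacy of open subgroups. -/
def conjSetoid (G : Type*) [Group G] [TopologicalSpace G] [IsTopologicalGroup G] :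
    Setoid (OpenSubgroup G) where
  r U V := ∃ g : G, V = conjOpen g U
  iseqv :=
    { refl := fun U => ⟨1, (conjOpen_one U).symm⟩
      symm := by
        rintro U V ⟨g, rfl⟩
        exact ⟨g⁻¹, by rw [conjOpen_conjOpen, inv_mul_cancel, conjOpen_one]⟩
      trans := by
        rintro U V W ⟨g, rfl⟩ ⟨h, rfl⟩
        exact ⟨h * g, by rw [conjOpen_conjOpen]⟩ }

/-- The set `𝒪(G)` of conjugacy classes of open subgroups of `G`. -/
def OClass (G : Type*) [Group G] [TopologicalSpace G] [IsTopologicalGroup G] : Type _ :=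
  Quotient (conjSetoid G)

/-- The class `[U]`. -/
def OClass.mk (U : OpenSubgroup G) : OClass G := Quotient.mk (conjSetoid G) U

theorem OClass.mk_conjOpen (g : G) (U : OpenSubgroup G) :
    OClass.mk (conjOpen g U) = OClass.mk U :=
  Quotient.sound (s := conjSetoid G) (Setoid.symm' (conjSetoid G) ⟨g, rfl⟩)

/-- `φ_V(G/W)`, the number of `V`-fixed points of the `G`-space `G/W`. -/
noncomputable def fixCard (V W : OpenSubgroup G) : ℕ :=
  Nat.card (MulAction.fixedPoints V (G ⧸ (W : Subgroup G)))

theorem fixCard_conj_left (g : G) (V W : OpenSubgroup G) :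
    fixCard (conjOpen g V) W = fixCard V W := by
  refine Nat.card_congr ((MulAction.toPerm (g⁻¹ : G) :
    Equiv.Perm (G ⧸ (W : Subgroup G))).subtypeEquiv ?_)
  intro c
  induction c using QuotientGroup.induction_on with
  | H a =>
    change _ ↔ (((g⁻¹ * a : G) : G ⧸ (W : Subgroup G)) ∈ MulAction.fixedPoints V _)
    refine Iff.trans (mk_mem_fixedPoints_iff (V := conjOpen g V) (W := W)) ?_
    rw [mk_mem_fixedPoints_iff]
    constructor
    · intro h v hv
      have := h (g * v * g⁻¹) (mem_conjOpen.2 (by simpa [mul_assoc] using hv))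
      simpa [mul_assoc] using this
    · intro h v hv
      have := h _ (mem_conjOpen.1 hv)
      simpa [mul_assoc] using this

theorem fixCard_conj_right (g : G) (V W : OpenSubgroup G) :
    fixCard V (conjOpen g W) = fixCard V W := by
  have key : ∀ (g : G) (W : OpenSubgroup G) (a b : G),
      (a : G ⧸ (conjOpen g W : Subgroup G)) = b →
        ((a * g : G) : G ⧸ (W : Subgroup G)) = (b * g : G) := by
    intro g W a b h
    have h1 : a⁻¹ * b ∈ conjOpen g W := QuotientGroup.eq.1 h
    refine QuotientGroup.eq.2 ?_
    have := mem_conjOpen.1 h1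
    simpa [mul_assoc] using this
  have key' : ∀ (a b : G), (a : G ⧸ (W : Subgroup G)) = b →
        ((a * g⁻¹ : G) : G ⧸ (conjOpen g W : Subgroup G)) = (b * g⁻¹ : G) := by
    intro a b h
    refine QuotientGroup.eq.2 ?_
    have h1 : a⁻¹ * b ∈ W := QuotientGroup.eq.1 h
    have : (a * g⁻¹)⁻¹ * (b * g⁻¹) ∈ conjOpen g W :=
      mem_conjOpen.2 (by simpa [mul_assoc] using h1)
    exact this
  let e : (G ⧸ (conjOpen g W : Subgroup G)) ≃ (G ⧸ (W : Subgroup G)) :=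
    { toFun := Quotient.lift (fun a => ((a * g : G) : G ⧸ (W : Subgroup G)))
        fun a b h => key g W a b (Quotient.sound h)
      invFun := Quotient.lift
        (fun a => ((a * g⁻¹ : G) : G ⧸ (conjOpen g W : Subgroup G)))
        fun a b h => key' a b (Quotient.sound h)
      left_inv := by
        intro c
        induction c using QuotientGroup.induction_on with
        | H a =>
          change ((a * g * g⁻¹ : G) : G ⧸ (conjOpen g W : Subgroup G)) = a
          simp
      right_inv := by
        intro c
        induction c using QuotientGroup.induction_on with
        | H a =>
          change ((a * g⁻¹ * g : G) : G ⧸ (W : Subgroup G)) = a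
          simp }
  refine Nat.card_congr (e.subtypeEquiv ?_)
  intro c
  induction c using QuotientGroup.induction_on with
  | H a =>
    change _ ↔ (((a * g : G) : G ⧸ (W : Subgroup G)) ∈ MulAction.fixedPoints V _)
    refine Iff.trans (mk_mem_fixedPoints_iff (V := V) (W := conjOpen g W)) ?_
    rw [mk_mem_fixedPoints_iff]
    simp [mem_conjOpen, mul_assoc]

/-- `V` is subconjugate to `W`: `V ⊆ g W g⁻¹` for some `g`. -/
def IsSubconj (V W : OpenSubgroup G) : Prop := ∃ g : G, V ≤ conjOpen g W

theorem isSubconj_conj (g h : G) (V W : OpenSubgroup G) :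
    IsSubconj (conjOpen g V) (conjOpen h W) ↔ IsSubconj V W := by
  constructor
  · rintro ⟨k, hk⟩
    refine ⟨g⁻¹ * k * h, fun v hv => ?_⟩
    have h1 : g * v * g⁻¹ ∈ conjOpen g V := mem_conjOpen.2 (by simpa [mul_assoc] using hv)
    have h2 := mem_conjOpen.1 (mem_conjOpen.1 (hk h1))
    exact mem_conjOpen.2 (by simpa [mul_assoc] using h2)
  · rintro ⟨k, hk⟩
    refine ⟨g * k * h⁻¹, fun v hv => ?_⟩
    have h2 := mem_conjOpen.1 (hk (mem_conjOpen.1 hv))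
    exact mem_conjOpen.2 (mem_conjOpen.2 (by simpa [mul_assoc] using h2))

theorem index_conjOpen (g : G) (V : OpenSubgroup G) :
    (conjOpen g V : Subgroup G).index = (V : Subgroup G).index :=
  (V : Subgroup G).index_comap_of_surjective (MulAut.conj g⁻¹).surjective

namespace OClass

/-- `W ⪯ V`, meaning that (a representative of) `V` is subconjugate to `W`. -/
def Prec (W V : OClass G) : Prop :=
  Quotient.liftOn₂ W V (fun W V => IsSubconj V W) (by
    rintro W V _ _ ⟨g, rfl⟩ ⟨h, rfl⟩
    exact propext (isSubconj_conj h g V W).symm)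

/-- `φ_V(G/W)` for classes `V`, `W`. -/
noncomputable def fix (V W : OClass G) : ℕ :=
  Quotient.liftOn₂ V W fixCard (by
    rintro V W _ _ ⟨g, rfl⟩ ⟨h, rfl⟩
    rw [fixCard_conj_left, fixCard_conj_right])

/-- The index `(G : V)`. -/
noncomputable def index (V : OClass G) : ℕ :=
  Quotient.liftOn V (fun V => (V : Subgroup G).index) (by
    rintro V _ ⟨g, rfl⟩
    exact (index_conjOpen g V).symm)

/-- `(W : V) = (G : V) / (G : W)`; used for `W ⪯ V` only, where the division is exact. -/
noncomputable def rel (W V : OClass G) : ℕ := V.index / W.index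

theorem prec_refl (V : OClass G) : Prec V V := by
  induction V using Quotient.inductionOn with
  | h V => exact ⟨1, (conjOpen_one V).ge⟩

/-- There are only finitely many classes `W ⪯ V`. -/
instance finite_below [CompactSpace G] (V : OClass G) : Finite {W : OClass G // Prec W V} := by
  induction V using Quotient.inductionOn with
  | h V =>
    have h1 : Finite {W : OpenSubgroup G // V ≤ W} := by
      refine Finite.of_injective
        (fun W => {c : G ⧸ (V : Subgroup G) | ∃ w ∈ W.1, (w : G ⧸ (V : Subgroup G)) = c}) ?_
      have aux : ∀ W W' : {W : OpenSubgroup G // V ≤ W},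
          {c : G ⧸ (V : Subgroup G) | ∃ w ∈ W.1, (w : G ⧸ (V : Subgroup G)) = c} =
          {c : G ⧸ (V : Subgroup G) | ∃ w ∈ W'.1, (w : G ⧸ (V : Subgroup G)) = c} →
          W.1 ≤ W'.1 := by
        intro W W' h x hx
        have : (x : G ⧸ (V : Subgroup G)) ∈
            {c : G ⧸ (V : Subgroup G) | ∃ w ∈ W.1, (w : G ⧸ (V : Subgroup G)) = c} := ⟨x, hx, rfl⟩
        rw [h] at this
        obtain ⟨w, hw, hwx⟩ := this
        have h2 : w⁻¹ * x ∈ W'.1 := W'.2 (QuotientGroup.eq.1 hwx)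
        simpa using mul_mem hw h2
      intro W W' h
      exact Subtype.ext (le_antisymm (aux W W' h) (aux W' W h.symm))
    refine Finite.of_surjective
      (fun W : {W : OpenSubgroup G // V ≤ W} =>
        (⟨OClass.mk W.1, ⟨1, by rw [conjOpen_one]; exact W.2⟩⟩ :
          {W : OClass G // Prec W (Quotient.mk (conjSetoid G) V)})) ?_
    rintro ⟨W, hW⟩
    induction W using Quotient.inductionOn with
    | h W =>
      obtain ⟨g, hg⟩ := hW
      exact ⟨⟨conjOpen g W, hg⟩, Subtype.ext (OClass.mk_conjOpen g W)⟩

/-- The finite set `𝒪(G,V)` of classes `W ⪯ V`. -/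
abbrev Below (V : OClass G) : Type _ := {W : OClass G // Prec W V}

noncomputable instance fintypeBelow [CompactSpace G] (V : OClass G) : Fintype (Below V) :=
  Fintype.ofFinite _

end OClass

instance isTopologicalGroup_openSubgroup (U : OpenSubgroup G) : IsTopologicalGroup U :=
  inferInstanceAs (IsTopologicalGroup (U : Subgroup G))

instance compactSpace_openSubgroup [CompactSpace G] (U : OpenSubgroup G) : CompactSpace U :=
  isCompact_iff_compactSpace.1 U.isClosed.isCompact

instance totallyDisconnectedSpace_openSubgroup [TotallyDisconnectedSpace G] (U : OpenSubgroup G) :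
    TotallyDisconnectedSpace U :=
  Subtype.totallyDisconnectedSpace

end Classes

/-! ## The `q`-necklace ring -/

section Necklace

variable {G : Type*} [Group G] [TopologicalSpace G] [IsTopologicalGroup G] [CompactSpace G]

open Classical in
/-- The matrix `ζ^q_G` over `ℚ[q]`, restricted to the classes in `𝒪(G,U)`. -/
noncomputable def zetaBelow (U : OClass G) :
    Matrix (OClass.Below U) (OClass.Below U) (Polynomial ℚ) :=
  fun V W =>
    if OClass.Prec W.1 V.1 then
      (OClass.fix V.1 W.1 : Polynomial ℚ) * Polynomial.X ^ (OClass.rel W.1 V.1 - 1)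
    else 0

open Classical in
/-- The entries over `ℚ[q]` of `μ^q_G`, the inverse of the lower triangular matrix `ζ^q_G`:
`μ^q_G(V,W)` is the `(V,W)` entry of the inverse of the restriction of `ζ^q_G` to `𝒪(G,V)`
if `W ⪯ V`, and `0` otherwise. -/
noncomputable def mu (V W : OClass G) : Polynomial ℚ :=
  if h : OClass.Prec W V then (zetaBelow V)⁻¹ ⟨V, OClass.prec_refl V⟩ ⟨W, h⟩ else 0

open Classical in
/-- The structure polynomials `P_{V,W}^U(q) ∈ ℚ[q]` of the multiplication:
the sum over `[V],[W] ⪯ [Z] ⪯ [U]` of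
`μ^q_G(U,Z) φ_Z(G/V) φ_Z(G/W) q^((V:Z)-1) q^((W:Z)-1)`. -/
noncomputable def structPoly (U V W : OClass G) : Polynomial ℚ :=
  ∑ Z : OClass.Below U,
    if OClass.Prec V Z.1 ∧ OClass.Prec W Z.1 then
      mu U Z.1 * (OClass.fix Z.1 V : Polynomial ℚ) * (OClass.fix Z.1 W : Polynomial ℚ) *
        Polynomial.X ^ (OClass.rel V Z.1 - 1) * Polynomial.X ^ (OClass.rel W Z.1 - 1)
    else 0

/-- The value of a numerical polynomial at an integer. -/
noncomputable def intEval (P : Polynomial ℚ) (q : ℤ) : ℤ := ⌊P.eval (q : ℚ)⌋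

/-- The value of `P` at `q` is an integer. -/
def IsIntegralAt (P : Polynomial ℚ) (q : ℤ) : Prop := ∃ z : ℤ, P.eval (q : ℚ) = z

/-- The ghost ring `Gh(G,A)`, with componentwise operations. -/
abbrev Gh (G A : Type*) [Group G] [TopologicalSpace G] [IsTopologicalGroup G] : Type _ :=
  OClass G → A

/-- The underlying set `A^𝒪(G)` of `Nr_G^q(A)`. -/
def Nr (_q : ℤ) (G A : Type*) [Group G] [TopologicalSpace G] [IsTopologicalGroup G] : Type _ :=
  OClass G → A

variable {A : Type*} [CommRing A] {q : ℤ}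

/-- The addition of `Nr_G^q(A)` is componentwise. -/
instance : AddCommGroup (Nr q G A) := inferInstanceAs (AddCommGroup (OClass G → A))

variable [SpecialLambdaRing A]

/-- The multiplication of `Nr_G^q(A)`. -/
noncomputable instance : Mul (Nr q G A) where
  mul x y := fun U => ∑ V : OClass.Below U, ∑ W : OClass.Below U,
    (intEval (structPoly U V.1 W.1) q : A) *
      (adams (OClass.rel V.1 U) (x V.1) * adams (OClass.rel W.1 U) (y W.1))

/-- The ghost map `x ↦ ζ̃^q_G x`. -/
noncomputable def ghost (x : Nr q G A) : Gh G A := fun V =>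
  ∑ W : OClass.Below V, (OClass.fix V W.1 : A) * (q : A) ^ (OClass.rel W.1 V - 1) *
    adams (OClass.rel W.1 V) (x W.1)

end Necklace

/-! ## `q`-induction and `q`-restriction -/

/-- An embedding of topological groups with open image. -/
structure OpenEmb (H K : Type*) [Group H] [TopologicalSpace H] [Group K] [TopologicalSpace K] where
  hom : H →* K
  isOpenEmbedding : Topology.IsOpenEmbedding hom

section IndRes

variable {H K : Type*} [Group H] [TopologicalSpace H] [IsTopologicalGroup H]
  [Group K] [TopologicalSpace K] [IsTopologicalGroup K]

/-- The image of an open subgroup. -/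
def OpenEmb.mapOpen (f : OpenEmb H K) (V : OpenSubgroup H) : OpenSubgroup K where
  toSubgroup := (V : Subgroup H).map f.hom
  isOpen' := f.isOpenEmbedding.isOpenMap _ V.isOpen

/-- The map `𝒪(H) → 𝒪(K)`, `[V] ↦ [f(V)]`. -/
def OpenEmb.mapClass (f : OpenEmb H K) (V : OClass H) : OClass K :=
  Quotient.liftOn V (fun V => OClass.mk (f.mapOpen V)) (by
    rintro V _ ⟨g, rfl⟩
    refine (OClass.mk_conjOpen (f.hom g) _).symm.trans (congrArg OClass.mk ?_)
    ext x
    rw [mem_conjOpen]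
    constructor
    · rintro ⟨v, hv, hvx⟩
      refine ⟨g * v * g⁻¹, mem_conjOpen.2 (by simpa [mul_assoc] using hv), ?_⟩
      simp [hvx, mul_assoc]
    · rintro ⟨v, hv, rfl⟩
      exact ⟨g⁻¹ * v * g, mem_conjOpen.1 hv, by simp⟩)

theorem OpenEmb.finite_fiber [CompactSpace K] (f : OpenEmb H K) (W : OClass K) :
    {V : OClass H | f.mapClass V = W}.Finite := by
  induction W using Quotient.inductionOn with
  | h W =>
    have hfin : Finite (K ⧸ (W : Subgroup K)) := inferInstance
    refine (Set.finite_range fun c : K ⧸ (W : Subgroup K) =>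
      OClass.mk ((conjOpen c.out W).comap f.hom f.isOpenEmbedding.continuous)).subset ?_
    intro V hV
    induction V using Quotient.inductionOn with
    | h V =>
      obtain ⟨g, hg⟩ := Quotient.exact (s := conjSetoid K) hV.symm
      refine ⟨(g : K ⧸ (W : Subgroup K)), congrArg OClass.mk ?_⟩
      obtain ⟨w, hw⟩ := QuotientGroup.mk_out_eq_mul (W : Subgroup K) g
      have hw' : conjOpen (g * (w : K)) W = conjOpen g W := by
        ext x
        rw [mem_conjOpen, mem_conjOpen]
        have hwW : (w : K) ∈ W := w.2
        have e : (g * (w : K))⁻¹ * x * (g * w) = (w : K)⁻¹ * (g⁻¹ * x * g) * w := by group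
        rw [e]
        constructor
        · intro h
          simpa [mul_assoc] using mul_mem (mul_mem hwW h) (inv_mem hwW)
        · intro h
          exact mul_mem (mul_mem (inv_mem hwW) h) hwW
      rw [hw, hw', ← hg]
      ext x
      constructor
      · rintro ⟨v, hv, hvx⟩
        rwa [f.isOpenEmbedding.injective hvx] at hv
      · intro hx
        exact ⟨x, hx, rfl⟩

variable {A : Type*} [CommRing A] {q : ℤ}

/-- Induction along an open embedding `f : H → K`: the `[W]`-component of `Ind x` is the sum of
`x [V]` over the classes `[V]` in `𝒪(H)` with `[f(V)] = [W]` in `𝒪(K)`. -/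
noncomputable def nrInd [CompactSpace K] (q : ℤ) (f : OpenEmb H K) (x : Nr q H A) : Nr q K A :=
  fun W => ∑ V ∈ (f.finite_fiber W).toFinset, x V

open Classical in
/-- The polynomials `Q_{V,W}(q) ∈ ℚ[q]` describing restriction along `f : H → K`: the sum over
the `[S]` in `𝒪(H)` with `[W] ⪯ [f(S)]` in `𝒪(K)` and `[S] ⪯ [V]` in `𝒪(H)` of
`μ^q_H(V,S) φ_{f(S)}(K/W) q^((W:f(S))-1)`. -/
noncomputable def resPoly [CompactSpace H] (f : OpenEmb H K) (V : OClass H) (W : OClass K) :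
    Polynomial ℚ :=
  ∑ S : OClass.Below V,
    if OClass.Prec W (f.mapClass S.1) then
      mu V S.1 * (OClass.fix (f.mapClass S.1) W : Polynomial ℚ) *
        Polynomial.X ^ (OClass.rel W (f.mapClass S.1) - 1)
    else 0

/-- `q`-restriction along an open embedding `f : H → K`, given by the matrix with entries
`Q_{V,W}(q) Ψ^(W:f(V))` for `[W] ⪯ [f(V)]`. -/
noncomputable def qRes [SpecialLambdaRing A] [CompactSpace H] [CompactSpace K] (q : ℤ)
    (f : OpenEmb H K) (x : Nr q K A) : Nr q H A :=
  fun V => ∑ W : OClass.Below (f.mapClass V),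
    (intEval (resPoly f V W.1) q : A) * adams (OClass.rel W.1 (f.mapClass V)) (x W.1)

end IndRes

theorem conj_mem_of_fixed {G : Type*} [Group G] [TopologicalSpace G]
    (U V : OpenSubgroup G) (g : G)
    (h : (g : G ⧸ (V : Subgroup G)) ∈ MulAction.fixedPoints U (G ⧸ (V : Subgroup G))) :
    ∀ u ∈ U, g⁻¹ * u * g ∈ V :=
  mk_mem_fixedPoints_iff.1 h

section Embeddings

variable {G : Type*} [Group G] [TopologicalSpace G] [IsTopologicalGroup G]

/-- The inclusion `U → G`. -/
def subtypeEmb (U : OpenSubgroup G) : OpenEmb U G where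
  hom := (U : Subgroup G).subtype
  isOpenEmbedding := U.isOpen.isOpenEmbedding_subtypeVal

/-- If `g` conjugates `U` into `V`, i.e. `g⁻¹ U g ⊆ V`, the embedding `U → V`, `u ↦ g⁻¹ u g`. -/
def conjEmb (U V : OpenSubgroup G) (g : G) (h : ∀ u ∈ U, g⁻¹ * u * g ∈ V) : OpenEmb U V where
  hom :=
    { toFun := fun u => ⟨g⁻¹ * u * g, h u u.2⟩
      map_one' := by ext; simp
      map_mul' := by intro a b; ext; simp [mul_assoc] }
  isOpenEmbedding := by
    have h1 : Topology.IsOpenEmbedding fun x : G => g⁻¹ * x * g :=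
      ((Homeomorph.mulLeft g⁻¹).trans (Homeomorph.mulRight g)).isOpenEmbedding
    have h2 : Topology.IsOpenEmbedding fun u : U => g⁻¹ * (u : G) * g :=
      h1.comp U.isOpen.isOpenEmbedding_subtypeVal
    exact Topology.IsOpenEmbedding.of_comp _ V.isOpen.isOpenEmbedding_subtypeVal h2

/-- For `U ⊆ V`, the inclusion `U → V`. -/
def inclEmb (U V : OpenSubgroup G) (h : U ≤ V) : OpenEmb U V where
  hom := Subgroup.inclusion h
  isOpenEmbedding :=
    Topology.IsOpenEmbedding.of_comp _ V.isOpen.isOpenEmbedding_subtypeVal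
      U.isOpen.isOpenEmbedding_subtypeVal

theorem conj_mem_of_mem_inter (U V : OpenSubgroup G) (g : G) :
    ∀ u ∈ U ⊓ conjOpen g V, g⁻¹ * u * g ∈ V :=
  fun _ hu => mem_conjOpen.1 hu.2

variable [CompactSpace G]

noncomputable instance fintypeDoubleCoset (U V : OpenSubgroup G) :
    Fintype (DoubleCoset.Quotient ((U : Subgroup G) : Set G) ((V : Subgroup G) : Set G)) := by
  have hfin : Finite (G ⧸ (V : Subgroup G)) := inferInstance
  have hs : Function.Surjective fun c : G ⧸ (V : Subgroup G) =>
      DoubleCoset.mk (U : Subgroup G) (V : Subgroup G) c.out := by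
    intro d
    induction d using Quotient.inductionOn' with
    | h g =>
      obtain ⟨w, hw⟩ := QuotientGroup.mk_out_eq_mul (V : Subgroup G) g
      refine ⟨(g : G ⧸ (V : Subgroup G)), (DoubleCoset.eq _ _ _ _).2
        ⟨1, one_mem _, (w : G)⁻¹, inv_mem w.2, ?_⟩⟩
      rw [hw]
      simp
  have := Finite.of_surjective _ hs
  exact Fintype.ofFinite _

noncomputable instance fintypeFixedPoints (U V : OpenSubgroup G) :
    Fintype (MulAction.fixedPoints U (G ⧸ (V : Subgroup G))) := by
  have hfin : Finite (G ⧸ (V : Subgroup G)) := inferInstance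
  exact Fintype.ofFinite _

end Embeddings

universe u v

/-! Everything is governed by one invertible triangular matrix. Since `ζ^q` is triangular for the
index with nonzero diagonal, its columns serve as a basis of the rational vectors on classes;
`ghostLin` and `coord` are the two mutually inverse changes of coordinates. In these terms
`P^U_{V,W}(q)` is the `U`-coordinate of the entrywise product of the columns `V` and `W`, and
`Q_{V,W}(q)` is the `V`-coordinate of the column `W` pulled back along `f`.

Integrality is checked one prime `p` at a time. If `p` divides `q`, then `φ_U(H/U) = (N(U):U)`
divides `φ_U(H/W) (W:U)` (`fix_self_dvd`), and the power of `p` in `(W:U)` already divides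
`q^((W:U)-1)`. Dividing each row of `ζ^q` by its diagonal entry therefore gives a unitriangular
`p`-integral matrix (`coord_mem_of_dvd`). If `p` does not divide `q`, the transition matrix from
`ζ^q` to `ζ^1` is unitriangular and `p`-integral (`coord_one_zetaInt_mem`): up to the unit `q`, the
powers `q^(H:Z)` are marks of sets of functions. This reduces the claim to `q = 1`, where it is the
statement of the Burnside ring that products and restrictions of finite `H`-sets are finite
`H`-sets.

The identities rest on a count of fixed points: a `Z`-fixed point of `K/f(S)` lies over a `Z`-fixed
coset `kV` of `K/V`, where `V = f(H)`, and corresponds to a fixed point of `f⁻¹(k⁻¹Zk)` on `H/S`.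
Hence ghost components of an induced vector are sums over fixed cosets (`ghostLin_indLin`).
Frobenius reciprocity and the Mackey formula are first proved for the integers `P` and `Q`, by
comparing ghost components over `ℚ`; for Mackey the fixed cosets are sorted by double cosets.

The ghost map over `A` need not be injective, so the passage to `A` compares coefficients of the
terms in `Ψ^n(x)`. It needs `Ψ^n` to be additive and `Ψ^m Ψ^n = Ψ^(mn)`. The composition law follows
from Newton's recursion and the injectivity of the substitution of elementary symmetric polynomials,
which replaces the splitting principle. -/

set_option linter.unusedSectionVars false

/-! ## Newton's recursion and the Adams operations -/

section AdamsOperations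

open Finset

/-- The sequence `p` obeys Newton's recursion for the sequence `l`, up to degree `M`;
`p n` plays the role of the power sum of degree `n + 1`. -/
def NewtonRec {B : Type*} [CommRing B] (l p : ℕ → B) (M : ℕ) : Prop :=
  ∀ n < M, ((n + 1 : ℕ) : B) * l (n + 1) =
    ∑ ij ∈ antidiagonal n, (-1) ^ ij.1 * p ij.1 * l ij.2

/-- Because `l 0 = 1` and the signs are units, the recursion can be solved for `p n` as an integral
polynomial in the `l k`. No division occurs, so the argument works in rings with torsion. -/
theorem NewtonRec.mem {B : Type*} [CommRing B] (T : Subring B) {l p : ℕ → B} {M : ℕ}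
    (h : NewtonRec l p M) (h0 : l 0 = 1) (hl : ∀ k ≤ M, l k ∈ T) : ∀ n < M, p n ∈ T := by
  intro n
  induction n using Nat.strong_induction_on with
  | _ n ih =>
    intro hn
    have h1 := h n hn
    rw [Nat.sum_antidiagonal_eq_sum_range_succ_mk, sum_range_succ] at h1
    simp only [Nat.sub_self, h0, mul_one] at h1
    have hs : ((-1) ^ n * (-1) ^ n : B) = 1 := by rw [← mul_pow]; simp
    have h2 : p n = (-1) ^ n * (((n + 1 : ℕ) : B) * l (n + 1) -
        ∑ i ∈ range n, (-1) ^ i * p i * l (n - i)) := by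
      rw [h1, add_sub_cancel_left, ← mul_assoc, hs, one_mul]
    rw [h2]
    have hneg : ∀ i, ((-1) ^ i : B) ∈ T := fun i => pow_mem (neg_mem (one_mem T)) i
    refine mul_mem (hneg n) (sub_mem (mul_mem (natCast_mem T _) (hl _ hn)) (sum_mem ?_))
    intro i hi
    rw [mem_range] at hi
    exact mul_mem (mul_mem (hneg i) (ih i hi (hi.trans hn))) (hl _ (by omega))

/-- Running two recursions side by side lets `NewtonRec.mem` be applied to a subring of a product,
that is, to a relation between two rings. -/
theorem NewtonRec.prod {B C : Type*} [CommRing B] [CommRing C] {l p : ℕ → B} {l' p' : ℕ → C}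
    {M : ℕ} (h : NewtonRec l p M) (h' : NewtonRec l' p' M) :
    NewtonRec (fun k => (l k, l' k)) (fun k => (p k, p' k)) M := by
  intro n hn
  refine Prod.ext ?_ ?_
  · simpa [Prod.fst_sum] using h n hn
  · simpa [Prod.snd_sum] using h' n hn

theorem newtonRec_mvPolynomial {σ : Type*} [Fintype σ] {B : Type*} [CommRing B] (y : σ → B)
    (M : ℕ) :
    NewtonRec (fun k => MvPolynomial.aeval y (MvPolynomial.esymm σ ℤ k))
      (fun k => ∑ i, y i ^ (k + 1)) M := by
  classical
  intro n _
  have h := congrArg (MvPolynomial.aeval y) (MvPolynomial.mul_esymm_eq_sum σ ℤ (n + 1))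
  rw [map_mul, map_natCast] at h
  refine h.trans ?_
  rw [sum_filter, Nat.sum_antidiagonal_succ', ← Nat.sum_antidiagonal_swap]
  simp only [lt_irrefl, if_false, map_mul, map_sum, map_pow, map_neg, map_one, zero_add]
  rw [mul_sum]
  refine sum_congr rfl fun ij hij => ?_
  rw [HasAntidiagonal.mem_antidiagonal] at hij
  rw [if_pos (by simp; omega)]
  simp only [MvPolynomial.psum, map_mul, map_sum, map_pow, map_neg, map_one, MvPolynomial.aeval_X,
    Prod.fst_swap, Prod.snd_swap]
  have hs : ((-1) ^ (n + 1 + 1) * (-1) ^ ij.2 : B) = (-1) ^ ij.1 := by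
    rw [← hij, ← pow_add]
    rw [show ij.1 + ij.2 + 1 + 1 + ij.2 = ij.1 + 2 * (ij.2 + 1) by ring, pow_add, pow_mul]
    simp
  rw [← hs]
  ring

theorem newtonRec_multiset {B : Type*} [CommRing B] (s : Multiset B) (M : ℕ) :
    NewtonRec s.esymm (fun k => (s.map (· ^ (k + 1))).sum) M := by
  classical
  have hs : (univ : Finset s).val.map (fun x : s => x.1) = s := Multiset.map_univ_coe s
  have h := newtonRec_mvPolynomial (fun x : s => x.1) M
  intro n hn
  have := h n hn
  simp only [MvPolynomial.aeval_esymm_eq_multiset_esymm, hs] at this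
  have h2 : ∀ k, ∑ i : s, (i.1 : B) ^ k = (s.map (· ^ k)).sum := by
    intro k
    conv_rhs => rw [← hs, Multiset.map_map]
    rfl
  simpa only [h2] using this

variable {A : Type*} [CommRing A] [SpecialLambdaRing A]

open SpecialLambdaRing

theorem lamSeries_mul_inv (a : A) :
    lamSeries a * PowerSeries.invOfUnit (lamSeries a) 1 = 1 := by
  refine PowerSeries.mul_invOfUnit _ _ ?_
  rw [← PowerSeries.coeff_zero_eq_constantCoeff_apply]
  simp [lamSeries, lam_zero]

/-- This compares coefficients in `λ_t' = (λ_t'/λ_t) λ_t`. -/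
theorem adams_newtonRec (a : A) (M : ℕ) :
    NewtonRec (fun k => lam k a) (fun k => adams (k + 1) a) M := by
  intro n _
  have h : PowerSeries.derivative A (lamSeries a) =
      PowerSeries.derivative A (lamSeries a) * PowerSeries.invOfUnit (lamSeries a) 1 *
        lamSeries a := by
    rw [mul_assoc, mul_comm _ (lamSeries a), lamSeries_mul_inv, mul_one]
  have h2 := congrArg (PowerSeries.coeff n) h
  rw [PowerSeries.coeff_mul, PowerSeries.coeff_derivative] at h2
  have h3 : ∀ k, PowerSeries.coeff k (lamSeries a) = lam k a := fun k => by simp [lamSeries]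
  simp only [h3] at h2
  push_cast
  rw [mul_comm, h2]
  refine sum_congr rfl fun ij _ => ?_
  have hs : ((-1) ^ ij.1 * (-1) ^ ij.1 : A) = 1 := by rw [← mul_pow]; simp
  simp only [adams, Nat.add_sub_cancel]
  rw [← mul_assoc ((-1 : A) ^ ij.1), hs, one_mul]

theorem lamSeries_add (a b : A) : lamSeries (a + b) = lamSeries a * lamSeries b := by
  ext n
  rw [PowerSeries.coeff_mul, Nat.sum_antidiagonal_eq_sum_range_succ_mk]
  simp [lamSeries, lam_add]

theorem adams_add (n : ℕ) (a b : A) : adams n (a + b) = adams n a + adams n b := by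
  have ha := lamSeries_mul_inv a
  have hb := lamSeries_mul_inv b
  have hab := lamSeries_mul_inv (a + b)
  set I := PowerSeries.invOfUnit (lamSeries a) 1 with hI
  set J := PowerSeries.invOfUnit (lamSeries b) 1 with hJ
  set K := PowerSeries.invOfUnit (lamSeries (a + b)) 1 with hK
  rw [lamSeries_add] at hab
  have hK' : K = I * J := by
    calc K = (lamSeries a * I) * (lamSeries b * J) * K := by rw [ha, hb]; ring
      _ = (lamSeries a * lamSeries b * K) * (I * J) := by ring
      _ = I * J := by rw [hab, one_mul]
  have h : PowerSeries.derivative A (lamSeries (a + b)) * K =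
      PowerSeries.derivative A (lamSeries a) * I + PowerSeries.derivative A (lamSeries b) * J := by
    rw [lamSeries_add, Derivation.leibniz, hK', smul_eq_mul, smul_eq_mul]
    calc _ = PowerSeries.derivative A (lamSeries b) * J * (lamSeries a * I) +
          PowerSeries.derivative A (lamSeries a) * I * (lamSeries b * J) := by ring
      _ = _ := by rw [ha, hb]; ring
  simp only [adams]
  rw [← hI, ← hJ, ← hK, h, map_add, mul_add]

/-- The Adams operation as an additive map. -/
noncomputable def adamsHom (n : ℕ) : A →+ A :=
  AddMonoidHom.mk' (adams n) (adams_add n)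

theorem adams_sum {ι : Type*} (n : ℕ) (s : Finset ι) (f : ι → A) :
    adams n (∑ i ∈ s, f i) = ∑ i ∈ s, adams n (f i) :=
  map_sum (adamsHom n) f s

theorem adams_intCast_mul (n : ℕ) (z : ℤ) (a : A) : adams n (z * a) = z * adams n a := by
  rw [← zsmul_eq_mul, ← zsmul_eq_mul]
  exact map_zsmul (adamsHom n) z a

theorem adams_one_left (a : A) : adams 1 a = a := by
  have h := adams_newtonRec a 1 0 one_pos
  simpa [lam_one, lam_zero] using h.symm

theorem adams_one_right (n : ℕ) : adams (n + 1) (1 : A) = 1 := by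
  have h : NewtonRec (fun k => (lam k (1 : A))) (fun _ => (1 : A)) (n + 1) := by
    intro k _
    rcases k with _ | k
    · simp [lam_one, lam_zero]
    · rw [Nat.sum_antidiagonal_eq_sum_range_succ_mk, sum_range_succ, sum_range_succ]
      rw [sum_eq_zero]
      · simp [lam_unit, lam_one, lam_zero, pow_succ]
      · intro i hi
        rw [mem_range] at hi
        simp [lam_unit (A := A) (k + 1 - i) (by omega)]
  -- Membership of the paired solutions in the diagonal subring of `A × A` is the uniqueness of the
  -- solution of the recursion.
  have h2 := h.prod (adams_newtonRec (1 : A) (n + 1))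
  have := h2.mem (RingHom.prod (RingHom.id A) (RingHom.id A)).range
    (by simp [lam_zero]) (fun k _ => ⟨lam k 1, rfl⟩) n (Nat.lt_succ_self n)
  obtain ⟨c, hc⟩ := this
  have h3 := congrArg Prod.fst hc
  have h4 := congrArg Prod.snd hc
  simp only [RingHom.prod_apply, RingHom.id_apply] at h3 h4
  rw [← h4, h3]

end AdamsOperations

/-! ## Multiplicativity and composition of Adams operations -/

section AdamsComposition

open Finset MvPolynomial

/-- The substitution of the elementary symmetric polynomials for the variables. -/
noncomputable def esymmSubst (N : ℕ) (R : Type*) [CommRing R] :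
    MvPolynomial (Fin N) R →ₐ[R] MvPolynomial (Fin N) R :=
  aeval fun i : Fin N => esymm (Fin N) R (i + 1)

theorem esymmSubst_injective (N : ℕ) (R : Type*) [CommRing R] :
    Function.Injective (esymmSubst N R) := by
  intro p q h
  refine esymmAlgHom_fin_injective R (le_refl N) (Subtype.ext ?_)
  rw [esymmAlgHom_apply, esymmAlgHom_apply]
  exact h

theorem exists_esymmSubst_eq {N : ℕ} {R : Type*} [CommRing R] {f : MvPolynomial (Fin N) R}
    (hf : f.IsSymmetric) : ∃ P, esymmSubst N R P = f := by
  obtain ⟨P, hP⟩ := (esymmAlgHom_fin_bijective R N).2 ⟨f, hf⟩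
  refine ⟨P, ?_⟩
  have := congrArg Subtype.val hP
  rwa [esymmAlgHom_apply] at this

theorem esymmSubst_map {N : ℕ} {R S : Type*} [CommRing R] [CommRing S] (φ : R →+* S)
    (P : MvPolynomial (Fin N) R) :
    map φ (esymmSubst N R P) = esymmSubst N S (map φ P) := by
  have : (map φ).comp (esymmSubst N R).toRingHom =
      (esymmSubst N S).toRingHom.comp (map (σ := Fin N) φ) := by
    refine ringHom_ext (fun r => ?_) (fun i => ?_)
    · simp [esymmSubst]
    · simp [esymmSubst, map_esymm]
  exact congrArg (fun ψ => ψ P) this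

/-- The substitution of the elementary symmetric polynomials in two blocks of variables. -/
noncomputable def esymmSubst₂ (N : ℕ) :
    MvPolynomial (Fin N ⊕ Fin N) ℤ →ₐ[ℤ] MvPolynomial (Fin N ⊕ Fin N) ℤ :=
  aeval (Sum.elim
    (fun i : Fin N => rename (Sum.inl : Fin N → Fin N ⊕ Fin N) (esymm (Fin N) ℤ (i + 1)))
    (fun j : Fin N => rename (Sum.inr : Fin N → Fin N ⊕ Fin N) (esymm (Fin N) ℤ (j + 1))))

theorem sumAlgEquiv_rename_inl {S T : Type*} (p : MvPolynomial S ℤ) :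
    sumAlgEquiv ℤ S T (rename Sum.inl p) = map C p := by
  have : (sumAlgEquiv ℤ S T).toRingEquiv.toRingHom.comp (rename Sum.inl).toRingHom =
      map (σ := S) C := by
    refine ringHom_ext (fun r => ?_) (fun i => ?_)
    · simp
    · simp
  exact congrArg (fun ψ => ψ p) this

theorem sumAlgEquiv_rename_inr {S T : Type*} (p : MvPolynomial T ℤ) :
    sumAlgEquiv ℤ S T (rename Sum.inr p) = C p := by
  have : (sumAlgEquiv ℤ S T).toRingEquiv.toRingHom.comp (rename Sum.inr).toRingHom = C := by
    refine ringHom_ext (fun r => ?_) (fun i => ?_)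
    · simp
    · simp
  exact congrArg (fun ψ => ψ p) this

/-- Viewed as polynomials in the first block over polynomials in the second, the two-block
substitution is the one-block substitution on coefficients followed by the one on the outer
variables. Injectivity and the description of the image thus reduce to one block. -/
theorem sumAlgEquiv_esymmSubst₂ {N : ℕ} (P : MvPolynomial (Fin N ⊕ Fin N) ℤ) :
    sumAlgEquiv ℤ (Fin N) (Fin N) (esymmSubst₂ N P) =
      esymmSubst N _ (map (esymmSubst N ℤ).toRingHom (sumAlgEquiv ℤ (Fin N) (Fin N) P)) := by
  have : (sumAlgEquiv ℤ (Fin N) (Fin N)).toRingEquiv.toRingHom.comp (esymmSubst₂ N).toRingHom =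
      ((esymmSubst N _).toRingHom.comp (map (esymmSubst N ℤ).toRingHom)).comp
        (sumAlgEquiv ℤ (Fin N) (Fin N)).toRingEquiv.toRingHom := by
    refine ringHom_ext (fun r => ?_) (fun i => ?_)
    · simp
    · rcases i with i | i
      · simp [esymmSubst₂, sumAlgEquiv_rename_inl, map_esymm, esymmSubst]
      · simp [esymmSubst₂, sumAlgEquiv_rename_inr, esymmSubst]
  exact congrArg (fun ψ => ψ P) this

theorem esymmSubst₂_injective (N : ℕ) : Function.Injective (esymmSubst₂ N) := by
  intro p q h
  have h2 := congrArg (sumAlgEquiv ℤ (Fin N) (Fin N)) h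
  rw [sumAlgEquiv_esymmSubst₂, sumAlgEquiv_esymmSubst₂] at h2
  exact (sumAlgEquiv ℤ (Fin N) (Fin N)).injective
    (map_injective _ (esymmSubst_injective N ℤ) (esymmSubst_injective N _ h2))

theorem sumAlgEquiv_rename_map {S T : Type*} (σ : Equiv.Perm S) (τ : Equiv.Perm T)
    (p : MvPolynomial (S ⊕ T) ℤ) :
    sumAlgEquiv ℤ S T (rename (Sum.map σ τ) p) =
      rename σ (map (rename τ).toRingHom (sumAlgEquiv ℤ S T p)) := by
  have : (sumAlgEquiv ℤ S T).toRingEquiv.toRingHom.comp (rename (Sum.map σ τ)).toRingHom =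
      ((rename σ).toRingHom.comp (map (rename τ).toRingHom)).comp
        (sumAlgEquiv ℤ S T).toRingEquiv.toRingHom := by
    refine ringHom_ext (fun r => ?_) (fun i => ?_)
    · simp
    · rcases i with i | i
      · simp
      · simp
  exact congrArg (fun ψ => ψ p) this

/-- The fundamental theorem on symmetric polynomials for two blocks of variables. -/
theorem exists_esymmSubst₂_eq {N : ℕ} {f : MvPolynomial (Fin N ⊕ Fin N) ℤ}
    (hf : ∀ σ τ : Equiv.Perm (Fin N), rename (Sum.map σ τ) f = f) :
    ∃ P, esymmSubst₂ N P = f := by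
  have hid : (rename (1 : Equiv.Perm (Fin N))).toRingHom =
      RingHom.id (MvPolynomial (Fin N) ℤ) :=
    ringHom_ext (fun r => by simp) (fun i => by simp)
  have h1 : (sumAlgEquiv ℤ (Fin N) (Fin N) f).IsSymmetric := by
    intro σ
    have := sumAlgEquiv_rename_map σ 1 f
    rw [hf, hid, MvPolynomial.map_id] at this
    exact this.symm
  obtain ⟨Q, hQ⟩ := exists_esymmSubst_eq h1
  -- Permuting the second block commutes with the outer substitution, which is injective, so `Q`
  -- inherits the invariance of `f`; its coefficients are then symmetric.
  have h2 : ∀ τ : Equiv.Perm (Fin N), map (rename τ).toRingHom Q = Q := by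
    intro τ
    apply esymmSubst_injective
    rw [← esymmSubst_map, hQ]
    have := sumAlgEquiv_rename_map 1 τ f
    rw [hf] at this
    conv_rhs => rw [this]
    exact (rename_id_apply _).symm
  have h3 : Q ∈ (map (σ := Fin N) (esymmSubst N ℤ).toRingHom).range := by
    rw [← SetLike.mem_coe, RingHom.coe_range, mem_range_map_iff_coeffs_subset]
    intro c hc
    obtain ⟨m, _, rfl⟩ := mem_coeffs_iff.1 (Finset.mem_coe.1 hc)
    have : (coeff m Q).IsSymmetric := by
      intro τ
      conv_rhs => rw [← h2 τ, coeff_map]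
      rfl
    obtain ⟨P, hP⟩ := exists_esymmSubst_eq this
    exact ⟨P, hP⟩
  obtain ⟨P, hP⟩ := h3
  refine ⟨(sumAlgEquiv ℤ (Fin N) (Fin N)).symm P, ?_⟩
  apply (sumAlgEquiv ℤ (Fin N) (Fin N)).injective
  rw [sumAlgEquiv_esymmSubst₂, AlgEquiv.apply_symm_apply, hP, hQ]

theorem aeval_X_comp {S T : Type*} (f : S → T) (p : MvPolynomial S ℤ) :
    aeval (fun i => (X (f i) : MvPolynomial T ℤ)) p = rename f p :=
  congrArg (fun ψ => ψ p) (algHom_ext (f := aeval fun i => (X (f i) : MvPolynomial T ℤ))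
    (g := rename f) fun i => by simp)

/-- With `e` injective, the range of `e.prod u` is the graph of a partial function. Applied to pairs
(symmetric polynomial, its value in `A`), it turns identities between symmetric polynomials into
identities in `A`. -/
theorem RingHom.eq_of_mem_range_prod {R S A : Type*} [Ring R] [Ring S] [Ring A] {e : R →+* S}
    {u : R →+* A} (he : Function.Injective e) {s : S} {b b' : A} (h : (s, b) ∈ (e.prod u).range)
    (h' : (s, b') ∈ (e.prod u).range) : b = b' := by
  obtain ⟨P, hP⟩ := h
  obtain ⟨P', hP'⟩ := h'
  have h1 := congrArg Prod.fst hP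
  have h2 := congrArg Prod.fst hP'
  have h3 := congrArg Prod.snd hP
  have h4 := congrArg Prod.snd hP'
  simp only [RingHom.prod_apply] at h1 h2 h3 h4
  rw [← h3, ← h4, he (h1.trans h2.symm)]

variable {A : Type*} [CommRing A] [SpecialLambdaRing A]

open SpecialLambdaRing

/-- The subring `T` below pairs each polynomial symmetric in both blocks with its value at the `λ^i
a` and `λ^j b`. By Newton's recursion it contains the power sums paired with the Adams operations,
and `lam_mul` puts the elementary symmetric functions of the products `x i * y j` into it. -/
theorem adams_mul (n : ℕ) (a b : A) : adams (n + 1) (a * b) = adams (n + 1) a * adams (n + 1) b := by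
  set N := n + 1 with hN
  let u : MvPolynomial (Fin N ⊕ Fin N) ℤ →ₐ[ℤ] A :=
    aeval (Sum.elim (fun i : Fin N => lam (i + 1) a) (fun j : Fin N => lam (j + 1) b))
  let T := ((esymmSubst₂ N).toRingHom.prod u.toRingHom).range
  have key : ∀ (y : Fin N × Fin N → MvPolynomial (Fin N ⊕ Fin N) ℤ),
      y = (fun p => X (Sum.inl p.1) * X (Sum.inr p.2)) →
      ((∑ p, y p ^ N, adams N (a * b)) : MvPolynomial (Fin N ⊕ Fin N) ℤ × A) ∈ T := by
    intro y hy
    refine ((newtonRec_mvPolynomial y N).prod (adams_newtonRec (a * b) N)).mem T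
      (by simp [esymm_zero, lam_zero]) (fun k hk => ?_) n (Nat.lt_succ_self n)
    have hsymm : ∀ σ τ : Equiv.Perm (Fin N),
        rename (Sum.map σ τ) (aeval y (esymm (Fin N × Fin N) ℤ k)) =
          aeval y (esymm (Fin N × Fin N) ℤ k) := by
      intro σ τ
      rw [← AlgHom.comp_apply, comp_aeval]
      have : (fun i => (rename (Sum.map σ τ)) (y i)) = y ∘ (Equiv.prodCongr σ τ) := by
        funext p
        simp [hy]
      rw [this, ← aeval_rename, rename_esymm]
    obtain ⟨P, hP⟩ := exists_esymmSubst₂_eq hsymm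
    refine ⟨P, Prod.ext hP ?_⟩
    refine (lam_mul k N hk P ?_ a b).symm
    refine hP.trans ?_
    rw [aeval_esymm_eq_multiset_esymm, hy]
  have keyl : ((∑ i : Fin N, X (Sum.inl i) ^ N, adams N a) :
      MvPolynomial (Fin N ⊕ Fin N) ℤ × A) ∈ T := by
    refine ((newtonRec_mvPolynomial (fun i : Fin N => (X (Sum.inl i) :
      MvPolynomial (Fin N ⊕ Fin N) ℤ)) N).prod (adams_newtonRec a N)).mem T
      (by simp [esymm_zero, lam_zero]) (fun k hk => ?_) n (Nat.lt_succ_self n)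
    rcases k with _ | k
    · simp only [esymm_zero, lam_zero, map_one]
      exact one_mem T
    · refine ⟨X (Sum.inl ⟨k, hk⟩), Prod.ext ?_ ?_⟩
      · simp only [esymmSubst₂, AlgHom.toRingHom_eq_coe, RingHom.prod_apply, RingHom.coe_coe,
          aeval_X, Sum.elim_inl]
        exact (aeval_X_comp Sum.inl _).symm
      · simp [u]
  have keyr : ((∑ i : Fin N, X (Sum.inr i) ^ N, adams N b) :
      MvPolynomial (Fin N ⊕ Fin N) ℤ × A) ∈ T := by
    refine ((newtonRec_mvPolynomial (fun i : Fin N => (X (Sum.inr i) :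
      MvPolynomial (Fin N ⊕ Fin N) ℤ)) N).prod (adams_newtonRec b N)).mem T
      (by simp [esymm_zero, lam_zero]) (fun k hk => ?_) n (Nat.lt_succ_self n)
    rcases k with _ | k
    · simp only [esymm_zero, lam_zero, map_one]
      exact one_mem T
    · refine ⟨X (Sum.inr ⟨k, hk⟩), Prod.ext ?_ ?_⟩
      · simp only [esymmSubst₂, AlgHom.toRingHom_eq_coe, RingHom.prod_apply, RingHom.coe_coe,
          aeval_X, Sum.elim_inr]
        exact (aeval_X_comp Sum.inr _).symm
      · simp [u]
  refine RingHom.eq_of_mem_range_prod (esymmSubst₂_injective N) (key _ rfl) ?_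
  -- The power sum of all products of variables is the product of the two power sums.
  convert mul_mem keyl keyr using 1
  refine Prod.ext ?_ rfl
  simp only [Prod.fst_mul, mul_pow, Fintype.sum_prod_type, sum_mul_sum]

/-- Both sides are paired with the power sum of degree `m * n`. Positivity matters: truncated
subtraction makes `adams 0` equal to `adams 1`. -/
theorem adams_adams (m n : ℕ) (hm : 0 < m) (hn : 0 < n) (a : A) :
    adams m (adams n a) = adams (m * n) a := by
  obtain ⟨m, rfl⟩ := Nat.exists_eq_succ_of_ne_zero hm.ne'
  obtain ⟨n, rfl⟩ := Nat.exists_eq_succ_of_ne_zero hn.ne'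
  set N := (m + 1) * (n + 1) with hN
  have hN0 : 0 < N := Nat.mul_pos hm hn
  let u : MvPolynomial (Fin N) ℤ →ₐ[ℤ] A := aeval fun i : Fin N => lam (i + 1) a
  let T := ((esymmSubst N ℤ).toRingHom.prod u.toRingHom).range
  have h1 : ((∑ i : Fin N, X i ^ N, adams N a) : MvPolynomial (Fin N) ℤ × A) ∈ T := by
    have := ((newtonRec_mvPolynomial (X : Fin N → MvPolynomial (Fin N) ℤ) N).prod
      (adams_newtonRec a N)).mem T (by simp [esymm_zero, lam_zero]) (fun k hk => ?_) (N - 1)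
      (by omega)
    · simpa only [Nat.sub_add_cancel hN0] using this
    rcases k with _ | k
    · simp only [esymm_zero, lam_zero, map_one]
      exact one_mem T
    · refine ⟨X ⟨k, hk⟩, Prod.ext ?_ ?_⟩
      · simp only [esymmSubst, AlgHom.toRingHom_eq_coe, RingHom.prod_apply, RingHom.coe_coe,
          aeval_X]
        exact (aeval_X_left_apply _).symm
      · simp [u]
  -- The power sum of degree `m + 1` of the squarefree monomials of degree `k` is the `k`-th
  -- elementary symmetric function of the `X i ^ (m + 1)`.
  have h2 : ∀ k ≤ n + 1, ((aeval (fun i => X i ^ (m + 1)) (esymm (Fin N) ℤ k),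
      adams (m + 1) (lam k a)) : MvPolynomial (Fin N) ℤ × A) ∈ T := by
    intro k hk
    let s : Multiset (MvPolynomial (Fin N) ℤ) :=
      (powersetCard k (univ : Finset (Fin N))).val.map fun S => ∏ i ∈ S, X i
    have := ((newtonRec_multiset s (m + 1)).prod (adams_newtonRec (lam k a) (m + 1))).mem T
      (by simp [Multiset.esymm, lam_zero]) (fun j hj => ?_) m (Nat.lt_succ_self m)
    · convert this using 1
      refine Prod.ext ?_ rfl
      rw [aeval_esymm_eq_multiset_esymm, Finset.esymm_map_val]
      simp only [s, Multiset.map_map, prod_pow]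
      rfl
    have hsymm : (s.esymm j).IsSymmetric := by
      intro σ
      have hs : s.map (rename σ) = s := by
        have h4 : (powersetCard k (univ : Finset (Fin N))).map
            (Finset.mapEmbedding σ.toEmbedding).toEmbedding = powersetCard k univ := by
          rw [← powersetCard_map, Finset.map_univ_equiv]
        conv_rhs => rw [show s = ((powersetCard k (univ : Finset (Fin N))).map
            (Finset.mapEmbedding σ.toEmbedding).toEmbedding).val.map (fun S => ∏ i ∈ S, X i) by
          rw [h4]]
        simp only [s, Multiset.map_map, Finset.map_val]
        refine Multiset.map_congr rfl fun S _ => ?_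
        simp [Finset.mapEmbedding_apply, Finset.prod_map]
      conv_rhs => rw [← hs]
      simp only [Multiset.esymm, Multiset.powersetCard_map, Multiset.map_map, map_multiset_sum,
        Function.comp_def, Multiset.prod_hom]
    obtain ⟨P, hP⟩ := exists_esymmSubst_eq hsymm
    exact ⟨P, Prod.ext hP (lam_lam j k N (Nat.mul_le_mul hj hk) P hP a).symm⟩
  have h3 : ((∑ i : Fin N, (X i ^ (m + 1)) ^ (n + 1), adams (m + 1) (adams (n + 1) a)) :
      MvPolynomial (Fin N) ℤ × A) ∈ T := by
    -- Applying the ring homomorphism `Ψ^(m+1)` to Newton's recursion for `a` gives a recursion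
    -- matching the one in the variables `X i ^ (m + 1)`.
    have hrec : NewtonRec (fun k => adams (m + 1) (lam k a))
        (fun k => adams (m + 1) (adams (k + 1) a)) (n + 1) := by
      intro k hk
      have := congrArg (adams (m + 1)) (adams_newtonRec a (n + 1) k hk)
      rw [adams_sum, ← Int.cast_natCast, adams_intCast_mul, Int.cast_natCast] at this
      refine this.trans (sum_congr rfl fun ij _ => ?_)
      have hz : ((-1) ^ ij.1 : A) = (((-1) ^ ij.1 : ℤ) : A) := by push_cast; rfl
      rw [mul_assoc, hz, adams_intCast_mul, adams_mul, mul_assoc]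
    exact ((newtonRec_mvPolynomial (fun i : Fin N => (X i ^ (m + 1) :
      MvPolynomial (Fin N) ℤ)) (n + 1)).prod hrec).mem T
      (by simp [esymm_zero, lam_zero, adams_one_right]) h2 n (Nat.lt_succ_self n)
  simp only [← pow_mul] at h3
  exact RingHom.eq_of_mem_range_prod (esymmSubst_injective N ℤ) h3 h1

end AdamsComposition

/-! ## The order on classes of open subgroups -/

section ClassOrder

variable {G : Type*} [Group G] [TopologicalSpace G] [IsTopologicalGroup G]

namespace OClass

theorem ind {p : OClass G → Prop} (h : ∀ V, p (OClass.mk V)) (c : OClass G) : p c :=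
  Quotient.inductionOn c h

theorem prec_mk {W V : OpenSubgroup G} : Prec (OClass.mk W) (OClass.mk V) ↔ IsSubconj V W :=
  Iff.rfl

theorem fix_mk (V W : OpenSubgroup G) : fix (OClass.mk V) (OClass.mk W) = fixCard V W := rfl

theorem index_mk (V : OpenSubgroup G) : index (OClass.mk V) = (V : Subgroup G).index := rfl

theorem prec_of_le {V W : OpenSubgroup G} (h : V ≤ W) : Prec (OClass.mk W) (OClass.mk V) :=
  ⟨1, by rwa [conjOpen_one]⟩

theorem exists_rep_of_prec {V : OpenSubgroup G} {W : OClass G} (h : Prec W (OClass.mk V)) :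
    ∃ W' : OpenSubgroup G, V ≤ W' ∧ OClass.mk W' = W := by
  induction W using OClass.ind with
  | h W =>
    obtain ⟨g, hg⟩ := h
    exact ⟨conjOpen g W, hg, OClass.mk_conjOpen g W⟩

theorem prec_trans {U V W : OClass G} (h : Prec U V) (h' : Prec V W) : Prec U W := by
  induction W using OClass.ind with
  | h W =>
    obtain ⟨V, hV, rfl⟩ := exists_rep_of_prec h'
    obtain ⟨U, hU, rfl⟩ := exists_rep_of_prec h
    exact prec_of_le (hV.trans hU)

theorem le_conjOpen_iff {V W : OpenSubgroup G} {g : G} :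
    V ≤ conjOpen g W ↔ ∀ v ∈ V, g⁻¹ * v * g ∈ W :=
  forall₂_congr fun _ _ => mem_conjOpen

theorem mk_mem_fixedPoints_iff_le {V W : OpenSubgroup G} {g : G} :
    (g : G ⧸ (W : Subgroup G)) ∈ MulAction.fixedPoints V (G ⧸ (W : Subgroup G)) ↔
      V ≤ conjOpen g W :=
  mk_mem_fixedPoints_iff.trans le_conjOpen_iff.symm

theorem index_dvd {V W : OClass G} (h : Prec W V) : index W ∣ index V := by
  induction V using OClass.ind with
  | h V =>
    obtain ⟨W, hW, rfl⟩ := exists_rep_of_prec h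
    exact Subgroup.index_dvd_of_le hW

theorem index_top : index (OClass.mk (⊤ : OpenSubgroup G)) = 1 :=
  Subgroup.index_top

theorem rel_top (V : OClass G) : rel (OClass.mk ⊤) V = index V := by
  rw [rel, index_top, Nat.div_one]

theorem fix_top (V : OClass G) : fix V (OClass.mk ⊤) = 1 := by
  induction V using OClass.ind with
  | h V =>
    rw [fix_mk, fixCard, Nat.card_eq_one_iff_unique]
    refine ⟨⟨fun a b => Subtype.ext ?_⟩, ⟨⟨((1 : G) : G ⧸ ((⊤ : OpenSubgroup G) : Subgroup G)),
      mk_mem_fixedPoints_iff.2 fun _ _ => trivial⟩⟩⟩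
    have : Subsingleton (G ⧸ ((⊤ : OpenSubgroup G) : Subgroup G)) :=
      QuotientGroup.subsingleton_quotient_top
    exact Subsingleton.elim _ _

variable [CompactSpace G]

theorem index_ne_zero (V : OClass G) : index V ≠ 0 := by
  induction V using OClass.ind with
  | h V => exact Subgroup.index_ne_zero_of_finite

theorem fix_ne_zero_iff {V W : OClass G} : fix V W ≠ 0 ↔ Prec W V := by
  induction V using OClass.ind with
  | h V =>
    induction W using OClass.ind with
    | h W =>
      rw [fix_mk, fixCard, prec_mk, Nat.card_ne_zero]
      constructor
      · rintro ⟨⟨c, hc⟩, _⟩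
        induction c using QuotientGroup.induction_on with
        | H g => exact ⟨g, mk_mem_fixedPoints_iff_le.1 hc⟩
      · rintro ⟨g, hg⟩
        exact ⟨⟨⟨(g : G ⧸ (W : Subgroup G)), mk_mem_fixedPoints_iff_le.2 hg⟩⟩, inferInstance⟩

theorem index_le {V W : OClass G} (h : Prec W V) : index W ≤ index V :=
  Nat.le_of_dvd (Nat.pos_of_ne_zero (index_ne_zero V)) (index_dvd h)

theorem openSubgroup_eq_of_le_of_index_eq {V W : OpenSubgroup G} (h : V ≤ W)
    (hi : (V : Subgroup G).index = (W : Subgroup G).index) : V = W := by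
  have h1 := Subgroup.relIndex_mul_index (H := (V : Subgroup G)) (K := (W : Subgroup G)) h
  have h0 : (W : Subgroup G).index ≠ 0 := Subgroup.index_ne_zero_of_finite
  rw [hi] at h1
  have h2 : (V : Subgroup G).relIndex W = 1 :=
    Nat.eq_of_mul_eq_mul_right (Nat.pos_of_ne_zero h0) (h1.trans (one_mul _).symm)
  exact le_antisymm h (Subgroup.relIndex_eq_one.1 h2)

theorem eq_of_prec_of_index_eq {V W : OClass G} (h : Prec W V) (hi : index V = index W) :
    V = W := by
  induction V using OClass.ind with
  | h V =>
    obtain ⟨W, hW, rfl⟩ := exists_rep_of_prec h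
    exact congrArg _ (openSubgroup_eq_of_le_of_index_eq hW hi)

theorem index_lt {V W : OClass G} (h : Prec W V) (hne : W ≠ V) : index W < index V :=
  lt_of_le_of_ne (index_le h) fun hi => hne (eq_of_prec_of_index_eq h hi.symm).symm

theorem rel_self (V : OClass G) : rel V V = 1 :=
  Nat.div_self (Nat.pos_of_ne_zero (index_ne_zero V))

theorem rel_pos {V W : OClass G} (h : Prec W V) : 0 < rel W V :=
  Nat.div_pos (index_le h) (Nat.pos_of_ne_zero (index_ne_zero W))

theorem rel_mul_rel {U V W : OClass G} (h : Prec U V) (h' : Prec V W) :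
    rel V W * rel U V = rel U W :=
  Nat.div_mul_div_comm (index_dvd h') (index_dvd h) |>.trans (by
    rw [mul_comm (index V) (index U)]
    exact Nat.mul_div_mul_right _ _ (Nat.pos_of_ne_zero (index_ne_zero V)))

/-- The finite set of classes `W ⪯ V`. -/
noncomputable def below (V : OClass G) : Finset (OClass G) :=
  have : Finite {W : OClass G | Prec W V} := finite_below V
  (Set.toFinite {W : OClass G | Prec W V}).toFinset

theorem mem_below {V W : OClass G} : W ∈ below V ↔ Prec W V := by simp [below]

theorem below_subset {V W : OClass G} (h : Prec W V) : below W ⊆ below V :=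
  fun _ hU => mem_below.2 (prec_trans (mem_below.1 hU) h)

theorem sum_Below {M : Type*} [AddCommMonoid M] (V : OClass G) (f : OClass G → M) :
    ∑ W : Below V, f W.1 = ∑ W ∈ below V, f W :=
  (Finset.sum_subtype (below V) (fun _ => mem_below) f).symm

theorem below_top : below (OClass.mk (⊤ : OpenSubgroup G)) = {OClass.mk ⊤} := by
  ext V
  rw [mem_below, Finset.mem_singleton]
  constructor
  · intro h
    obtain ⟨W, hW, rfl⟩ := exists_rep_of_prec h
    rw [top_le_iff.1 hW]
  · rintro rfl
    exact prec_refl _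

end OClass

end ClassOrder

/-! ## The ghost coordinates over `ℚ` -/

section GhostCoordinates

open OClass Finset

variable {G : Type*} [Group G] [TopologicalSpace G] [IsTopologicalGroup G]

theorem zetaBelow_eq_zero {U : OClass G} {V W : Below U} (h : ¬ Prec W.1 V.1) :
    zetaBelow U V W = 0 := if_neg h

theorem zetaBelow_eq {U : OClass G} {V W : Below U} (h : Prec W.1 V.1) :
    zetaBelow U V W = (fix V.1 W.1 : Polynomial ℚ) * Polynomial.X ^ (rel W.1 V.1 - 1) := if_pos h

variable [CompactSpace G]

/-- The matrix `ζ^q_G` at an integer `q`. -/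
noncomputable def zetaInt (q : ℤ) (V W : OClass G) : ℤ := fix V W * q ^ (rel W V - 1)

/-- The order condition in `ζ^q` is automatic: without it `H/W` has no `V`-fixed point. This also
makes the value of the exponent irrelevant there. -/
theorem zetaInt_eq_zero {q : ℤ} {V W : OClass G} (h : ¬ Prec W V) : zetaInt q V W = 0 := by
  rw [zetaInt, not_not.1 fun h' => h (fix_ne_zero_iff.1 h')]
  simp

theorem zetaInt_self (q : ℤ) (V : OClass G) : zetaInt q V V = fix V V := by
  simp [zetaInt, rel_self]

theorem isUnit_det_zetaBelow (U : OClass G) [DecidableEq (Below U)] :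
    IsUnit (zetaBelow U).det := by
  -- The index is dualized because the entries that vanish are those whose column has larger index
  -- than the row. Within one index the block is diagonal, with nonzero constants since the exponent
  -- of `q` is `1 - 1`.
  let b : Below U → ℕᵒᵈ := fun W => OrderDual.toDual (index W.1)
  have hb : (zetaBelow U).BlockTriangular b := by
    intro V W h
    refine zetaBelow_eq_zero fun hp => ?_
    exact (index_le hp).not_gt (OrderDual.toDual_lt_toDual.1 h)
  rw [hb.det]
  refine IsUnit.prod_iff.2 fun k _ => ?_
  have hd : (zetaBelow U).toSquareBlock b k = Matrix.diagonal fun V => zetaBelow U V.1 V.1 := by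
    refine Matrix.ext fun V W => ?_
    rw [Matrix.toSquareBlock_def, Matrix.of_apply, Matrix.diagonal_apply]
    split_ifs with h
    · rw [h]
    · refine zetaBelow_eq_zero fun hp => h (Subtype.ext (Subtype.ext ?_))
      exact eq_of_prec_of_index_eq hp (OrderDual.toDual.injective (V.2.trans W.2.symm))
  rw [hd, Matrix.det_diagonal]
  refine IsUnit.prod_iff.2 fun V _ => ?_
  rw [zetaBelow_eq (prec_refl _), rel_self, Nat.sub_self, pow_zero, mul_one, ← map_natCast
    Polynomial.C]
  exact Polynomial.isUnit_C.2 (IsUnit.mk0 _ (Nat.cast_ne_zero.2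
    (fix_ne_zero_iff.2 (prec_refl _))))

/-- The entries of `μ^q_G` at an integer `q`. -/
noncomputable def muRat (q : ℤ) (V W : OClass G) : ℚ := (mu V W).eval (q : ℚ)

open Classical in
theorem sum_mu_mul_zetaBelow {U : OClass G} (W : Below U) :
    ∑ Z : Below U, mu U Z.1 * zetaBelow U Z W = if W.1 = U then 1 else 0 := by
  have h := Matrix.nonsing_inv_mul _ (isUnit_det_zetaBelow U)
  have h2 := congrFun (congrFun h ⟨U, prec_refl U⟩) W
  rw [Matrix.mul_apply, Matrix.one_apply] at h2
  convert h2 using 1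
  · refine sum_congr rfl fun Z _ => ?_
    rw [mu, dif_pos Z.2]
  · refine if_congr ?_ rfl rfl
    rw [Subtype.ext_iff]
    exact eq_comm

/-- The linear map `a ↦ μ^q_G a`. -/
noncomputable def coord (q : ℤ) (a : OClass G → ℚ) (U : OClass G) : ℚ :=
  ∑ Z ∈ below U, muRat q U Z * a Z

/-- The linear map `h ↦ ζ^q_G h`. -/
noncomputable def ghostLin (q : ℤ) (h : OClass G → ℚ) (V : OClass G) : ℚ :=
  ∑ W ∈ below V, zetaInt q V W * h W

theorem ghostLin_eq_sum {q : ℤ} {h : OClass G → ℚ} {V : OClass G} {s : Finset (OClass G)}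
    (hs : below V ⊆ s) : ghostLin q h V = ∑ W ∈ s, zetaInt q V W * h W := by
  refine sum_subset hs fun W _ hW => ?_
  rw [zetaInt_eq_zero fun h => hW (mem_below.2 h)]
  simp

theorem coord_congr {q : ℤ} {a b : OClass G → ℚ} {U : OClass G}
    (h : ∀ Z, Prec Z U → a Z = b Z) : coord q a U = coord q b U :=
  sum_congr rfl fun Z hZ => by rw [h Z (mem_below.1 hZ)]

theorem coord_sum {ι : Type*} (q : ℤ) (s : Finset ι) (a : ι → OClass G → ℚ) (U : OClass G) :
    coord q (fun Z => ∑ i ∈ s, a i Z) U = ∑ i ∈ s, coord q (a i) U := by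
  simp only [coord, mul_sum]
  exact sum_comm

theorem coord_mul_left (q : ℤ) (c : ℚ) (a : OClass G → ℚ) (U : OClass G) :
    coord q (fun Z => c * a Z) U = c * coord q a U := by
  simp only [coord, mul_sum]
  exact sum_congr rfl fun Z _ => by ring

open Classical in
theorem coord_zetaInt (q : ℤ) (U W : OClass G) :
    coord q (fun Z => zetaInt q Z W) U = if W = U then 1 else 0 := by
  by_cases h : Prec W U
  · have h2 := congrArg (Polynomial.eval (q : ℚ)) (sum_mu_mul_zetaBelow ⟨W, h⟩)
    rw [Polynomial.eval_finsetSum] at h2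
    have h3 : (if W = U then (1 : Polynomial ℚ) else 0).eval (q : ℚ) = if W = U then 1 else 0 := by
      split_ifs <;> simp
    rw [h3] at h2
    rw [← h2, coord, ← sum_Below U fun Z => muRat q U Z * (zetaInt q Z W : ℚ)]
    refine sum_congr rfl fun Z _ => ?_
    rw [Polynomial.eval_mul, muRat]
    congr 1
    by_cases hZ : Prec W Z.1
    · rw [zetaBelow_eq hZ, zetaInt]
      simp
    · rw [zetaBelow_eq_zero hZ, zetaInt_eq_zero hZ]
      simp
  · rw [if_neg (fun h' : W = U => h (h' ▸ prec_refl _)), coord]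
    refine sum_eq_zero fun Z hZ => ?_
    rw [zetaInt_eq_zero fun h' => h (prec_trans h' (mem_below.1 hZ))]
    simp

theorem coord_ghostLin (q : ℤ) (h : OClass G → ℚ) (U : OClass G) :
    coord q (ghostLin q h) U = h U := by
  classical
  have h1 : coord q (ghostLin q h) U =
      coord q (fun Z => ∑ W ∈ below U, h W * zetaInt q Z W) U := by
    refine coord_congr fun Z hZ => ?_
    rw [ghostLin_eq_sum (below_subset hZ)]
    exact sum_congr rfl fun W _ => mul_comm _ _
  rw [h1, coord_sum]
  simp only [coord_mul_left, coord_zetaInt]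
  simp [mem_below, prec_refl]

theorem ghostLin_injective {q : ℤ} {h h' : OClass G → ℚ} (e : ∀ Z, ghostLin q h Z = ghostLin q h' Z)
    (U : OClass G) : h U = h' U := by
  rw [← coord_ghostLin q h, ← coord_ghostLin q h', funext e]

theorem coord_injective {q : ℤ} {a b : OClass G → ℚ} (e : ∀ U, coord q a U = coord q b U)
    (U : OClass G) : a U = b U := by
  classical
  induction hn : index U using Nat.strong_induction_on generalizing U with
  | _ n ih =>
    have h := e U
    rw [coord, coord, ← add_sum_erase _ _ (mem_below.2 (prec_refl U)),
      ← add_sum_erase _ _ (mem_below.2 (prec_refl U))] at h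
    have h2 : ∑ Z ∈ (below U).erase U, muRat q U Z * a Z =
        ∑ Z ∈ (below U).erase U, muRat q U Z * b Z := by
      refine sum_congr rfl fun Z hZ => ?_
      rw [mem_erase, mem_below] at hZ
      rw [ih _ (hn ▸ index_lt hZ.2 hZ.1) Z rfl]
    rw [h2, add_left_inj] at h
    refine mul_left_cancel₀ (fun h0 => ?_) h
    -- The diagonal entry of `μ^q` is nonzero because its product with the diagonal entry of `ζ^q`
    -- is `1`.
    have h3 := coord_zetaInt q U U
    rw [if_pos rfl, coord, sum_eq_single U] at h3
    · rw [h0, zero_mul] at h3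
      exact zero_ne_one h3
    · intro Z hZ hne
      rw [mem_below] at hZ
      rw [zetaInt_eq_zero fun h' => hne (eq_of_prec_of_index_eq hZ
        (le_antisymm (index_le h') (index_le hZ))).symm]
      simp
    · exact fun h' => absurd (mem_below.2 (prec_refl U)) h'

/-- Each row of `mu` comes from the inverse of a different finite matrix, so only the left inverse
property is immediate. The other side follows from the injectivity of `coord`. -/
theorem ghostLin_coord (q : ℤ) (a : OClass G → ℚ) (U : OClass G) :
    ghostLin q (coord q a) U = a U :=
  coord_injective (fun _ => coord_ghostLin q _ _) U

/-- Thus the `P^U_{V,W}(q)` are the structure constants of the entrywise product in the basis of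
columns of `ζ^q`. -/
theorem eval_structPoly (q : ℤ) (U V W : OClass G) :
    (structPoly U V W).eval (q : ℚ) =
      coord q (fun Z => (zetaInt q Z V : ℚ) * (zetaInt q Z W : ℚ)) U := by
  rw [structPoly, Polynomial.eval_finsetSum, coord,
    ← sum_Below U fun Z => muRat q U Z * ((zetaInt q Z V : ℚ) * (zetaInt q Z W : ℚ))]
  refine sum_congr rfl fun Z _ => ?_
  split_ifs with h
  · simp only [zetaInt, muRat, Polynomial.eval_mul, Polynomial.eval_natCast, Polynomial.eval_pow,
      Polynomial.eval_X]
    push_cast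
    ring
  · rw [not_and_or] at h
    rcases h with h | h <;> rw [zetaInt_eq_zero h] <;> simp

theorem eval_resPoly {K : Type*} [Group K] [TopologicalSpace K] [IsTopologicalGroup K]
    [CompactSpace K] (q : ℤ) (f : OpenEmb G K) (V : OClass G) (W : OClass K) :
    (resPoly f V W).eval (q : ℚ) = coord q (fun S => (zetaInt q (f.mapClass S) W : ℚ)) V := by
  rw [resPoly, Polynomial.eval_finsetSum, coord,
    ← sum_Below V fun S => muRat q V S * (zetaInt q (f.mapClass S) W : ℚ)]
  refine sum_congr rfl fun S _ => ?_
  split_ifs with h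
  · simp only [zetaInt, muRat, Polynomial.eval_mul, Polynomial.eval_natCast, Polynomial.eval_pow,
      Polynomial.eval_X]
    push_cast
    ring
  · rw [zetaInt_eq_zero h]
    simp

theorem eval_structPoly_eq_zero (q : ℤ) {U V W : OClass G} (h : ¬ (Prec V U ∧ Prec W U)) :
    (structPoly U V W).eval (q : ℚ) = 0 := by
  rw [eval_structPoly, coord]
  refine sum_eq_zero fun Z hZ => ?_
  rw [mem_below] at hZ
  rw [not_and_or] at h
  rcases h with h | h <;> rw [zetaInt_eq_zero fun h' => h (prec_trans h' hZ)] <;> simp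

end GhostCoordinates

/-! ## Induction of marks -/

section Induction

open OClass Finset

variable {H K : Type*} [Group H] [TopologicalSpace H] [IsTopologicalGroup H]
  [Group K] [TopologicalSpace K] [IsTopologicalGroup K]

namespace OpenEmb

theorem mapClass_mk (f : OpenEmb H K) (V : OpenSubgroup H) :
    f.mapClass (OClass.mk V) = OClass.mk (f.mapOpen V) := rfl

theorem mem_mapOpen (f : OpenEmb H K) {V : OpenSubgroup H} {x : K} :
    x ∈ f.mapOpen V ↔ ∃ v ∈ V, f.hom v = x := Iff.rfl

theorem prec_mapClass (f : OpenEmb H K) {V W : OClass H} (h : Prec W V) :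
    Prec (f.mapClass W) (f.mapClass V) := by
  induction V using OClass.ind with
  | h V =>
    obtain ⟨W, hW, rfl⟩ := exists_rep_of_prec h
    exact prec_of_le (Subgroup.map_mono hW)

theorem index_mapClass (f : OpenEmb H K) (V : OClass H) :
    index (f.mapClass V) = index V * f.hom.range.index := by
  induction V using OClass.ind with
  | h V => exact Subgroup.index_map_of_injective _ f.isOpenEmbedding.injective

/-- The preimage `f⁻¹(k⁻¹ Z k)`. -/
def pull (f : OpenEmb H K) (k : K) (Z : OpenSubgroup K) : OpenSubgroup H :=
  (conjOpen k⁻¹ Z).comap f.hom f.isOpenEmbedding.continuous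

theorem mem_pull (f : OpenEmb H K) {k : K} {Z : OpenSubgroup K} {h : H} :
    h ∈ f.pull k Z ↔ k * f.hom h * k⁻¹ ∈ Z := by
  refine Iff.trans (OpenSubgroup.mem_comap) ?_
  rw [mem_conjOpen, inv_inv]

theorem mapOpen_pull (f : OpenEmb H K) {V : OpenSubgroup K} (hV : f.hom.range = (V : Subgroup K))
    {k : K} {Z : OpenSubgroup K} (h : Z ≤ conjOpen k V) :
    f.mapOpen (f.pull k Z) = conjOpen k⁻¹ Z := by
  ext x
  rw [mem_mapOpen, mem_conjOpen, inv_inv]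
  constructor
  · rintro ⟨v, hv, rfl⟩
    exact f.mem_pull.1 hv
  · intro hx
    have h1 : x ∈ (V : Subgroup K) := by
      have := mem_conjOpen.1 (h hx)
      simpa [mul_assoc] using this
    rw [← hV] at h1
    obtain ⟨v, rfl⟩ := h1
    exact ⟨v, f.mem_pull.2 hx, rfl⟩

theorem mapClass_pull (f : OpenEmb H K) {V : OpenSubgroup K}
    (hV : f.hom.range = (V : Subgroup K)) {k : K} {Z : OpenSubgroup K} (h : Z ≤ conjOpen k V) :
    f.mapClass (OClass.mk (f.pull k Z)) = OClass.mk Z := by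
  rw [mapClass_mk, f.mapOpen_pull hV h, OClass.mk_conjOpen]

/-- The set `K/f(S)` fibres over `K/V`. A fixed point of `Z` lies over a fixed coset `kV`, which
means `k⁻¹Zk ⊆ V`; the fibre is a copy of `H/S` on which `Z` acts through `f⁻¹(k⁻¹Zk)`. -/
theorem fixCard_mapOpen (f : OpenEmb H K) {V : OpenSubgroup K}
    (hV : f.hom.range = (V : Subgroup K)) (Z : OpenSubgroup K) (S : OpenSubgroup H)
    [Fintype (MulAction.fixedPoints Z (K ⧸ (V : Subgroup K)))]
    [∀ T : OpenSubgroup H, Finite (H ⧸ (T : Subgroup H))]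
    (r : MulAction.fixedPoints Z (K ⧸ (V : Subgroup K)) → K)
    (hr : ∀ c, (r c : K ⧸ (V : Subgroup K)) = c.1) :
    fixCard Z (f.mapOpen S) = ∑ c, fixCard (f.pull (r c) Z) S := by
  -- This parametrizes the fibre over `kV`.
  let φ (k : K) : H ⧸ (S : Subgroup H) → K ⧸ (f.mapOpen S : Subgroup K) :=
    Quotient.map' (fun h => k * f.hom h) (by
      intro a b hab
      rw [QuotientGroup.leftRel_apply] at hab ⊢
      exact ⟨a⁻¹ * b, hab, by simp [mul_assoc]⟩)
  have hφ : ∀ k (h : H), φ k (h : H ⧸ (S : Subgroup H)) =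
      ((k * f.hom h : K) : K ⧸ (f.mapOpen S : Subgroup K)) := fun _ _ => rfl
  have hfix : ∀ k (c : H ⧸ (S : Subgroup H)), Z ≤ conjOpen k V →
      (φ k c ∈ MulAction.fixedPoints Z (K ⧸ (f.mapOpen S : Subgroup K)) ↔
        c ∈ MulAction.fixedPoints (f.pull k Z) (H ⧸ (S : Subgroup H))) := by
    intro k c hk
    induction c using QuotientGroup.induction_on with
    | H a =>
      rw [hφ, mk_mem_fixedPoints_iff, mk_mem_fixedPoints_iff]
      constructor
      · intro h v hv
        obtain ⟨s, hs, hsv⟩ := f.mem_mapOpen.1 (h _ (f.mem_pull.1 hv))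
        have : f.hom s = f.hom (a⁻¹ * v * a) := by rw [hsv]; simp [mul_assoc]
        rwa [f.isOpenEmbedding.injective this] at hs
      · intro h z hz
        have h1 : k⁻¹ * z * k ∈ (V : Subgroup K) := mem_conjOpen.1 (hk hz)
        rw [← hV] at h1
        obtain ⟨v, hv⟩ := h1
        refine f.mem_mapOpen.2 ⟨_, h v (f.mem_pull.2 ?_), ?_⟩
        · rw [hv]; simpa [mul_assoc] using hz
        · simp [hv, mul_assoc]
  have hle : ∀ c, Z ≤ conjOpen (r c) V := by
    intro c
    rw [← mk_mem_fixedPoints_iff_le, hr]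
    exact c.2
  let Φ : (Σ c, MulAction.fixedPoints (f.pull (r c) Z) (H ⧸ (S : Subgroup H))) →
      MulAction.fixedPoints Z (K ⧸ (f.mapOpen S : Subgroup K)) :=
    fun p => ⟨φ (r p.1) p.2.1, (hfix _ _ (hle p.1)).2 p.2.2⟩
  have hΦ : Function.Bijective Φ := by
    constructor
    · rintro ⟨c, x, hx⟩ ⟨c', x', hx'⟩ h
      have h1 : φ (r c) x = φ (r c') x' := congrArg Subtype.val h
      induction x using QuotientGroup.induction_on with
      | H a =>
        induction x' using QuotientGroup.induction_on with
        | H a' =>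
          rw [hφ, hφ] at h1
          obtain ⟨s, hs, hs'⟩ := QuotientGroup.eq.1 h1
          have hc : c = c' := by
            apply Subtype.ext
            rw [← hr, ← hr]
            refine QuotientGroup.eq.2 ?_
            rw [← hV]
            refine ⟨a * s * a'⁻¹, ?_⟩
            rw [map_mul, map_mul, hs']
            simp [mul_assoc]
          subst hc
          have : f.hom s = f.hom (a⁻¹ * a') := by rw [hs']; simp [mul_assoc]
          rw [f.isOpenEmbedding.injective this] at hs
          congr 2
          exact QuotientGroup.eq.2 hs
    · rintro ⟨x, hx⟩
      induction x using QuotientGroup.induction_on with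
      | H k =>
        have hk : (k : K ⧸ (V : Subgroup K)) ∈
            MulAction.fixedPoints Z (K ⧸ (V : Subgroup K)) := by
          rw [mk_mem_fixedPoints_iff] at hx ⊢
          intro z hz
          obtain ⟨s, _, hs'⟩ := hx z hz
          have : k⁻¹ * z * k ∈ f.hom.range := ⟨s, hs'⟩
          rwa [hV] at this
        have h1 : (r ⟨_, hk⟩)⁻¹ * k ∈ (V : Subgroup K) := QuotientGroup.eq.1 (hr ⟨_, hk⟩)
        obtain ⟨h, hh⟩ := hV.ge h1
        have h2 : φ (r ⟨_, hk⟩) (h : H ⧸ (S : Subgroup H)) = (k : K ⧸ (f.mapOpen S : Subgroup K)) := by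
          rw [hφ, hh]
          simp
        exact ⟨⟨⟨_, hk⟩, ⟨(h : H ⧸ (S : Subgroup H)),
          (hfix _ _ (hle ⟨_, hk⟩)).1 (by rw [h2]; exact hx)⟩⟩, Subtype.ext h2⟩
  rw [fixCard, ← Nat.card_congr (Equiv.ofBijective Φ hΦ), Nat.card_sigma]
  rfl

variable [CompactSpace K]

theorem index_range_ne_zero (f : OpenEmb H K) : f.hom.range.index ≠ 0 := by
  intro h0
  have := f.index_mapClass (OClass.mk ⊤)
  rw [h0, mul_zero] at this
  exact index_ne_zero _ this

theorem rel_mapClass (f : OpenEmb H K) (V W : OClass H) :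
    rel (f.mapClass W) (f.mapClass V) = rel W V := by
  rw [rel, f.index_mapClass, f.index_mapClass]
  exact Nat.mul_div_mul_right _ _ (Nat.pos_of_ne_zero f.index_range_ne_zero)

/-- The finite set of classes whose image lies in a given finite set. -/
noncomputable def preim (f : OpenEmb H K) (s : Finset (OClass K)) : Finset (OClass H) :=
  (s.finite_toSet.preimage' fun W _ => f.finite_fiber W).toFinset

theorem mem_preim (f : OpenEmb H K) {s : Finset (OClass K)} {V : OClass H} :
    V ∈ f.preim s ↔ f.mapClass V ∈ s := by simp [preim]

/-- The finite set of classes with a given image. -/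
noncomputable def fiber (f : OpenEmb H K) (W : OClass K) : Finset (OClass H) :=
  (f.finite_fiber W).toFinset

theorem mem_fiber (f : OpenEmb H K) {W : OClass K} {V : OClass H} :
    V ∈ f.fiber W ↔ f.mapClass V = W := by simp [fiber]

theorem sum_sum_fiber {M : Type*} [AddCommMonoid M] (f : OpenEmb H K) (s : Finset (OClass K))
    (F : OClass K → OClass H → M) :
    ∑ W ∈ s, ∑ V ∈ f.fiber W, F W V = ∑ V ∈ f.preim s, F (f.mapClass V) V := by
  classical
  rw [← sum_fiberwise_of_maps_to (g := f.mapClass) (t := s) fun V hV => f.mem_preim.1 hV]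
  refine sum_congr rfl fun W hW => ?_
  have : f.fiber W = (f.preim s).filter fun V => f.mapClass V = W := by
    ext V
    rw [mem_fiber, mem_filter, mem_preim]
    exact ⟨fun h => ⟨h ▸ hW, h⟩, fun h => h.2⟩
  rw [this]
  exact sum_congr rfl fun V hV => by rw [(mem_filter.1 hV).2]

variable [CompactSpace H]

/-- The fixed point count survives the weighting by powers of `q`: passing from `H` to `K`
multiplies all indices by `(K : V)`, so every summand carries the same exponent as the left side. -/
theorem zetaInt_mapClass (f : OpenEmb H K) {V : OpenSubgroup K}
    (hV : f.hom.range = (V : Subgroup K)) (q : ℤ) (Z : OpenSubgroup K)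
    [Fintype (MulAction.fixedPoints Z (K ⧸ (V : Subgroup K)))]
    (r : MulAction.fixedPoints Z (K ⧸ (V : Subgroup K)) → K)
    (hr : ∀ c, (r c : K ⧸ (V : Subgroup K)) = c.1) (S : OClass H) :
    zetaInt q (OClass.mk Z) (f.mapClass S) =
      ∑ c, zetaInt q (OClass.mk (f.pull (r c) Z)) S := by
  induction S using OClass.ind with
  | h S =>
    simp only [zetaInt, mapClass_mk, fix_mk, f.fixCard_mapOpen hV Z S r hr]
    rw [Nat.cast_sum, sum_mul]
    refine sum_congr rfl fun c _ => ?_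
    have hle : Z ≤ conjOpen (r c) V := by
      rw [← mk_mem_fixedPoints_iff_le, hr]
      exact c.2
    have h1 := f.rel_mapClass (OClass.mk (f.pull (r c) Z)) (OClass.mk S)
    rw [f.mapClass_pull hV hle] at h1
    rw [← h1, mapClass_mk]

/-- Induction of coordinate vectors. -/
noncomputable def indLin (f : OpenEmb H K) (g : OClass H → ℚ) (W : OClass K) : ℚ :=
  ∑ V ∈ f.fiber W, g V

theorem ghostLin_indLin (f : OpenEmb H K) {V : OpenSubgroup K}
    (hV : f.hom.range = (V : Subgroup K)) (q : ℤ) (Z : OpenSubgroup K)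
    [Fintype (MulAction.fixedPoints Z (K ⧸ (V : Subgroup K)))]
    (r : MulAction.fixedPoints Z (K ⧸ (V : Subgroup K)) → K)
    (hr : ∀ c, (r c : K ⧸ (V : Subgroup K)) = c.1) (g : OClass H → ℚ) :
    ghostLin q (f.indLin g) (OClass.mk Z) =
      ∑ c, ghostLin q g (OClass.mk (f.pull (r c) Z)) := by
  have h1 : ∀ c, below (OClass.mk (f.pull (r c) Z)) ⊆ f.preim (below (OClass.mk Z)) := by
    intro c S hS
    have hle : Z ≤ conjOpen (r c) V := by
      rw [← mk_mem_fixedPoints_iff_le, hr]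
      exact c.2
    rw [mem_preim, mem_below, ← f.mapClass_pull hV hle]
    exact f.prec_mapClass (mem_below.1 hS)
  simp only [ghostLin_eq_sum (h1 _)]
  rw [sum_comm]
  simp only [ghostLin, indLin, mul_sum]
  rw [f.sum_sum_fiber]
  refine sum_congr rfl fun S _ => ?_
  rw [f.zetaInt_mapClass hV q Z r hr, Int.cast_sum, sum_mul]

end OpenEmb

end Induction

/-! ## Local integrality -/

section LocalIntegers

/-- The ring of rational numbers that are integral at `p`. -/
noncomputable def localIntegers (p : ℕ) [Fact p.Prime] : Subring ℚ :=
  (PadicInt.subring p).comap (Rat.castHom ℚ_[p])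

theorem mem_localIntegers {p : ℕ} [Fact p.Prime] {x : ℚ} :
    x ∈ localIntegers p ↔ ‖(x : ℚ_[p])‖ ≤ 1 := Iff.rfl

theorem norm_intCast_eq_one {p : ℕ} [Fact p.Prime] {z : ℤ} (h : ¬ (p : ℤ) ∣ z) :
    ‖(z : ℚ_[p])‖ = 1 := by
  have h1 := (PadicInt.norm_int_lt_one_iff_dvd (p := p) z).not.2 h
  have h2 : ‖(z : ℤ_[p])‖ = ‖(z : ℚ_[p])‖ := by
    rw [PadicInt.norm_def, PadicInt.coe_intCast]
  rw [h2] at h1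
  exact le_antisymm (Padic.norm_int_le_one z) (not_lt.1 h1)

theorem inv_mem_localIntegers {p : ℕ} [Fact p.Prime] {z : ℤ} (h : ¬ (p : ℤ) ∣ z) :
    (z : ℚ)⁻¹ ∈ localIntegers p := by
  rw [mem_localIntegers]
  push_cast
  rw [norm_inv, norm_intCast_eq_one h, inv_one]

theorem exists_int_of_forall_mem_localIntegers {x : ℚ}
    (h : ∀ (p : ℕ) [Fact p.Prime], x ∈ localIntegers p) : ∃ z : ℤ, x = z := by
  refine ⟨x.num, ?_⟩
  by_contra hx
  have hd : x.den ≠ 1 := fun hd => hx (Rat.coe_int_num_of_den_eq_one hd).symm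
  obtain ⟨p, hp, hpd⟩ := Nat.exists_prime_and_dvd hd
  have : Fact p.Prime := ⟨hp⟩
  have h1 := mem_localIntegers.1 (h p)
  have h2 : ¬ (p : ℤ) ∣ x.num := by
    intro h3
    have h4 : p ∣ x.num.natAbs := Int.natCast_dvd.1 h3
    exact hp.one_lt.ne' (Nat.dvd_one.1 (x.reduced ▸ Nat.dvd_gcd h4 hpd))
  have h3 : ‖((x.den : ℤ) : ℚ_[p])‖ < 1 := by
    have := (PadicInt.norm_int_lt_one_iff_dvd (p := p) (x.den : ℤ)).2 (Int.natCast_dvd_natCast.2 hpd)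
    rwa [PadicInt.norm_def, PadicInt.coe_intCast] at this
  have h4 : (x : ℚ_[p]) * ((x.den : ℤ) : ℚ_[p]) = (x.num : ℚ_[p]) := by
    exact_mod_cast congrArg (Rat.cast : ℚ → ℚ_[p]) (Rat.mul_den_eq_num x)
  have h5 := congrArg norm h4
  rw [norm_mul, norm_intCast_eq_one h2] at h5
  have : ‖(x : ℚ_[p])‖ * ‖((x.den : ℤ) : ℚ_[p])‖ < 1 :=
    (mul_le_of_le_one_left (norm_nonneg _) h1).trans_lt h3
  exact this.ne h5

theorem exists_mem_localIntegers_mul {p : ℕ} [Fact p.Prime] {n φ r : ℕ} {q : ℤ} (hr : 0 < r)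
    (hq : (p : ℤ) ∣ q) (h : n ∣ φ * r) :
    ∃ c ∈ localIntegers p, (φ * q ^ (r - 1) : ℚ) = c * n := by
  -- Write `r = p^v m` with `m` a unit at `p`. Since `v < p^v ≤ r`, the factor `p^v` divides
  -- `q^(r-1)` and can replace the `p`-part of `r`.
  obtain ⟨v, m, hm, rfl⟩ := Nat.exists_eq_pow_mul_and_not_dvd hr.ne' p (Fact.out : p.Prime).ne_one
  obtain ⟨t, ht⟩ := h
  have hv : v ≤ p ^ v * m - 1 := by
    have h1 : v < p ^ v := Nat.lt_pow_self (Fact.out : p.Prime).one_lt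
    have h2 : p ^ v ≤ p ^ v * m := Nat.le_mul_of_pos_right _ (Nat.pos_of_mul_pos_left hr)
    omega
  obtain ⟨s, hs⟩ : (p : ℤ) ^ v ∣ q ^ (p ^ v * m - 1) :=
    (pow_dvd_pow_of_dvd hq v).trans (pow_dvd_pow q hv)
  have hm0 : (m : ℚ) ≠ 0 := by
    rintro h0
    have : m = 0 := by exact_mod_cast h0
    simp [this] at hm
  refine ⟨t * s * ((m : ℤ) : ℚ)⁻¹, mul_mem (mul_mem (natCast_mem _ _) (intCast_mem _ _))
    (inv_mem_localIntegers fun h => hm (Int.natCast_dvd_natCast.1 h)), ?_⟩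
  have hs' : (q : ℚ) ^ (p ^ v * m - 1) = p ^ v * s := by exact_mod_cast hs
  have ht' : (φ : ℚ) * (p ^ v * m) = n * t := by exact_mod_cast ht
  rw [hs', Int.cast_natCast]
  field_simp
  linear_combination (s : ℚ) * ht'

theorem forall_int_exists_eval_eq {F : Polynomial ℚ}
    (h : ∀ n : ℕ, ∃ z : ℤ, F.eval (n : ℚ) = z) (q : ℤ) : ∃ z : ℤ, F.eval (q : ℚ) = z := by
  obtain ⟨d, hd, hg⟩ := IsLocalization.integerNormalization_spec (nonZeroDivisors ℤ) F
  set g := IsLocalization.integerNormalization (nonZeroDivisors ℤ) F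
  have hd0 : d ≠ 0 := nonZeroDivisors.ne_zero hd
  have he : ∀ z : ℤ, ((g.eval z : ℤ) : ℚ) = d * F.eval (z : ℚ) := by
    intro z
    have := congrArg (Polynomial.eval (z : ℚ)) hg
    rw [← eq_intCast (algebraMap ℤ ℚ) z, Polynomial.eval_map_apply] at this
    simpa using this
  -- A natural number congruent to `q` modulo the common denominator `d`; the integral polynomial `g
  -- = d F` takes congruent values at both. The factor `d * d ≥ 1` ensures nonnegativity for either
  -- sign of `d`.
  let n : ℕ := (q + d * (d * |q|)).toNat
  have hn : (n : ℤ) = q + d * (d * |q|) := by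
    refine Int.toNat_of_nonneg ?_
    have h1 : 1 ≤ d * d := Int.add_one_le_iff.2 (mul_self_pos.2 hd0)
    nlinarith [neg_abs_le q, abs_nonneg q]
  obtain ⟨z, hz⟩ := h n
  have h1 : d ∣ g.eval (n : ℤ) := ⟨z, by
    have := he n
    rw [Int.cast_natCast, hz] at this
    exact_mod_cast this⟩
  have h2 : d ∣ g.eval (n : ℤ) - g.eval q :=
    (Dvd.intro (d * |q|) (by rw [hn]; ring)).trans (Polynomial.sub_dvd_eval_sub (n : ℤ) q g)
  obtain ⟨w, hw⟩ := (dvd_sub_right h1).1 h2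
  refine ⟨w, ?_⟩
  have h3 := he q
  rw [hw] at h3
  push_cast at h3
  exact (mul_left_cancel₀ (Int.cast_ne_zero.2 hd0) h3).symm

end LocalIntegers

/-! ### Divisibility of marks by the diagonal of `ζ^q`, and primes dividing `q` -/

section Divisibility

open OClass Finset

/-- An orbit contributes `(N : Stab)` to the cardinality, and `(N : Z) = (N : Stab)(Stab : Z)`
divides `(N : Stab) r`. -/
theorem relIndex_dvd_card_mul {H : Type*} [Group H] (Z N : Subgroup H) {X : Type*} [Finite X]
    [MulAction N X] (r : ℕ)
    (h : ∀ x : X, Z.subgroupOf N ≤ MulAction.stabilizer N x ∧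
      (Z.subgroupOf N).relIndex (MulAction.stabilizer N x) ∣ r) :
    Z.relIndex N ∣ Nat.card X * r := by
  have := Fintype.ofFinite (MulAction.orbitRel.Quotient N X)
  have e := MulAction.selfEquivSigmaOrbitsQuotientStabilizer N X
  have hf : ∀ ω : MulAction.orbitRel.Quotient N X,
      Finite (N ⧸ MulAction.stabilizer N ω.out) := fun ω =>
    Finite.of_injective (fun c => e.symm ⟨ω, c⟩) fun a b hab => by
      simpa using e.symm.injective hab
  rw [Nat.card_congr e, Nat.card_sigma, sum_mul]
  refine dvd_sum fun ω _ => ?_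
  obtain ⟨h1, h2⟩ := h ω.out
  rw [Subgroup.relIndex, ← Subgroup.relIndex_mul_index h1, mul_comm]
  exact mul_dvd_mul_left _ h2

variable {H K : Type*} [Group H] [TopologicalSpace H] [IsTopologicalGroup H] [CompactSpace H]
  [Group K] [TopologicalSpace K] [IsTopologicalGroup K] [CompactSpace K]

/-- A fixed coset `gZ` gives `Z ≤ gZg⁻¹`, and equality of the finite indices forces `g` to normalize
`Z`. -/
theorem fixCard_self (Z : OpenSubgroup H) :
    fixCard Z Z = (Z : Subgroup H).relIndex (Subgroup.normalizer ((Z : Subgroup H) : Set H)) := by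
  set N := Subgroup.normalizer ((Z : Subgroup H) : Set H) with hN
  have hiff : ∀ g : H, (g : H ⧸ (Z : Subgroup H)) ∈
      MulAction.fixedPoints Z (H ⧸ (Z : Subgroup H)) ↔ g ∈ N := by
    intro g
    rw [mk_mem_fixedPoints_iff_le]
    constructor
    · intro h
      have h1 := openSubgroup_eq_of_le_of_index_eq h (index_conjOpen g Z).symm
      rw [hN, ← inv_mem_iff, Subgroup.mem_normalizer_iff]
      intro x
      rw [inv_inv]
      change x ∈ Z ↔ _
      rw [h1, mem_conjOpen, ← h1]
      rfl
    · intro h v hv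
      rw [hN, ← inv_mem_iff, Subgroup.mem_normalizer_iff] at h
      have := (h v).1 hv
      rw [inv_inv] at this
      exact mem_conjOpen.2 this
  have hmem : ∀ a b : N, (QuotientGroup.leftRel ((Z : Subgroup H).subgroupOf N)) a b ↔
      ((a : H) : H ⧸ (Z : Subgroup H)) = (b : H) := by
    intro a b
    rw [QuotientGroup.leftRel_apply, QuotientGroup.eq]
    rfl
  let Φ : N ⧸ (Z : Subgroup H).subgroupOf N → MulAction.fixedPoints Z (H ⧸ (Z : Subgroup H)) :=
    Quotient.lift (fun n => ⟨((n : H) : H ⧸ (Z : Subgroup H)), (hiff _).2 n.2⟩)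
      fun a b hab => Subtype.ext ((hmem a b).1 hab)
  have hΦ : Function.Bijective Φ := by
    constructor
    · intro a b
      refine Quotient.inductionOn₂ a b fun a b hab => Quotient.sound ((hmem a b).2 ?_)
      exact congrArg Subtype.val hab
    · rintro ⟨c, hc⟩
      induction c using QuotientGroup.induction_on with
      | H g => exact ⟨QuotientGroup.mk ⟨g, (hiff g).1 hc⟩, rfl⟩
  exact (Nat.card_congr (Equiv.ofBijective Φ hΦ)).symm

/-- The normalizer of `Z` acts through `f` on the `f(Z)`-fixed points of `K/W`. The stabilizer of
`kW` contains `Z` and is mapped by `f` into `kWk⁻¹`, so its index over `Z` divides `(W : f(Z))`;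
then the orbits are counted. -/
theorem fix_self_dvd (f : OpenEmb H K) (Z : OClass H) (W : OClass K) :
    fix Z Z ∣ fix (f.mapClass Z) W * rel W (f.mapClass Z) := by
  induction Z using OClass.ind with
  | h Z =>
    induction W using OClass.ind with
    | h W =>
      rw [fix_mk, fixCard_self, f.mapClass_mk, fix_mk, fixCard]
      set N := Subgroup.normalizer ((Z : Subgroup H) : Set H) with hN
      have hsmul : ∀ (n : N) (x : MulAction.fixedPoints (f.mapOpen Z) (K ⧸ (W : Subgroup K))),
          f.hom n • x.1 ∈ MulAction.fixedPoints (f.mapOpen Z) (K ⧸ (W : Subgroup K)) := by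
        rintro n ⟨x, hx⟩
        induction x using QuotientGroup.induction_on with
        | H k =>
          change ((f.hom n * k : K) : K ⧸ (W : Subgroup K)) ∈ _
          rw [mk_mem_fixedPoints_iff] at hx ⊢
          intro v hv
          obtain ⟨z, hz, rfl⟩ := f.mem_mapOpen.1 hv
          have h1 : (n : H)⁻¹ * z * n ∈ Z := by
            have := (Subgroup.mem_normalizer_iff.1 (inv_mem n.2) z).1 hz
            rwa [inv_inv] at this
          have := hx _ (f.mem_mapOpen.2 ⟨_, h1, rfl⟩)
          simpa [mul_assoc] using this
      let _ : MulAction N (MulAction.fixedPoints (f.mapOpen Z) (K ⧸ (W : Subgroup K))) :=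
        { smul := fun n x => ⟨f.hom n • x.1, hsmul n x⟩
          one_smul := fun x => Subtype.ext (by
            change f.hom ((1 : N) : H) • x.1 = x.1
            simp)
          mul_smul := fun a b x => Subtype.ext (by
            change f.hom ((a * b : N) : H) • x.1 = f.hom a • f.hom b • x.1
            simp [mul_smul]) }
      refine relIndex_dvd_card_mul (Z : Subgroup H) N _ ?_
      rintro ⟨x, hx⟩
      induction x using QuotientGroup.induction_on with
      | H k =>
        set A := MulAction.stabilizer N (⟨(k : K ⧸ (W : Subgroup K)), hx⟩ :
          MulAction.fixedPoints (f.mapOpen Z) (K ⧸ (W : Subgroup K))) with hA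
        have hmem : ∀ n : N, n ∈ A ↔ f.hom n ∈ conjOpen k W := by
          intro n
          rw [hA, MulAction.mem_stabilizer_iff, mem_conjOpen, Subtype.ext_iff]
          change ((f.hom n * k : K) : K ⧸ (W : Subgroup K)) = k ↔ _
          rw [eq_comm, QuotientGroup.eq, mul_assoc]
          rfl
        have hle := mk_mem_fixedPoints_iff_le.1 hx
        have hZA : (Z : Subgroup H).subgroupOf N ≤ A := by
          intro n hn
          exact (hmem n).2 (hle (f.mem_mapOpen.2 ⟨n, hn, rfl⟩))
        refine ⟨hZA, ?_⟩
        let B : Subgroup H := A.map N.subtype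
        have hZN : (Z : Subgroup H) ≤ N := Subgroup.le_normalizer
        have hB : ((Z : Subgroup H).subgroupOf N).relIndex A = (Z : Subgroup H).relIndex B := by
          rw [← Subgroup.relIndex_map_map_of_injective _ A N.subtype_injective,
            Subgroup.map_subgroupOf_eq_of_le hZN]
        have hB' : (Z : Subgroup H).relIndex B =
            ((Z : Subgroup H).map f.hom).relIndex (B.map f.hom) :=
          (Subgroup.relIndex_map_map_of_injective _ _ f.isOpenEmbedding.injective).symm
        have hBW : B.map f.hom ≤ (conjOpen k W : Subgroup K) := by
          rintro _ ⟨_, ⟨n, hn, rfl⟩, rfl⟩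
          exact (hmem n).1 hn
        have hZB : (Z : Subgroup H) ≤ B := fun z hz => ⟨⟨z, hZN hz⟩, hZA hz, rfl⟩
        have hrel : rel (OClass.mk W) (OClass.mk (f.mapOpen Z)) =
            ((Z : Subgroup H).map f.hom).relIndex (conjOpen k W : Subgroup K) := by
          rw [← OClass.mk_conjOpen k W]
          refine Nat.div_eq_of_eq_mul_left (Nat.pos_of_ne_zero (index_ne_zero _)) ?_
          exact (Subgroup.relIndex_mul_index hle).symm
        rw [hB, hB', hrel]
        exact Dvd.intro _ (Subgroup.relIndex_mul_relIndex _ _ _ (Subgroup.map_mono hZB) hBW)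

theorem fix_dvd_fix_mul_rel (U W : OClass H) : fix U U ∣ fix U W * rel W U := by
  let f : OpenEmb H H := ⟨MonoidHom.id H, Topology.IsOpenEmbedding.id⟩
  have hU : f.mapClass U = U := by
    induction U using OClass.ind with
    | h U =>
      refine congrArg OClass.mk (OpenSubgroup.ext fun x => ?_)
      exact ⟨fun ⟨v, hv, e⟩ => e ▸ hv, fun hx => ⟨x, hx, rfl⟩⟩
  have h := fix_self_dvd f U W
  rwa [hU] at h

/-- Triangular systems with unit diagonal over a subring have solutions in the subring. -/
theorem mem_of_triangular (R : Subring ℚ) (c : OClass H → OClass H → ℚ) (x : OClass H → ℚ)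
    (h1 : ∀ U, c U U = 1) (hc : ∀ U W, Prec W U → c U W ∈ R)
    (h : ∀ U, ∑ W ∈ below U, c U W * x W ∈ R) (U : OClass H) : x U ∈ R := by
  classical
  induction hn : index U using Nat.strong_induction_on generalizing U with
  | _ n ih =>
    have h2 := h U
    rw [← add_sum_erase _ _ (mem_below.2 (prec_refl U)), h1, one_mul] at h2
    have h3 : ∑ W ∈ (below U).erase U, c U W * x W ∈ R := by
      refine sum_mem fun W hW => ?_
      rw [mem_erase, mem_below] at hW
      exact mul_mem (hc U W hW.2) (ih _ (hn ▸ index_lt hW.2 hW.1) W rfl)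
    simpa using sub_mem h2 h3

/-- At the primes dividing `q`, the coordinates of a vector are integral as soon as its entries
are divisible by the diagonal entries of `ζ^q`. -/
theorem coord_mem_of_dvd {p : ℕ} [Fact p.Prime] {q : ℤ} (hq : (p : ℤ) ∣ q) {a : OClass H → ℚ}
    (ha : ∀ U, ∃ c ∈ localIntegers p, a U = c * fix U U) (U : OClass H) :
    coord q a U ∈ localIntegers p := by
  have h0 : ∀ U : OClass H, (fix U U : ℚ) ≠ 0 := fun U =>
    Nat.cast_ne_zero.2 (fix_ne_zero_iff.2 (prec_refl U))
  -- Each row of `ζ^q` is divided by its diagonal entry, so that the diagonal becomes `1` and the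
  -- remaining entries stay `p`-integral.
  refine mem_of_triangular _ (fun U W => zetaInt q U W / fix U U) _ (fun U => ?_)
    (fun U W h => ?_) (fun U => ?_) U
  · rw [zetaInt_self, Int.cast_natCast, div_self (h0 U)]
  · obtain ⟨c, hc, e⟩ := exists_mem_localIntegers_mul (rel_pos h) hq (fix_dvd_fix_mul_rel U W)
    simp only [zetaInt]
    push_cast
    rw [e, mul_div_cancel_right₀ _ (h0 U)]
    exact hc
  · obtain ⟨c, hc, e⟩ := ha U
    have := ghostLin_coord q a U
    rw [ghostLin, e] at this
    simp only [div_mul_eq_mul_div]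
    rw [← sum_div, this, mul_div_cancel_right₀ _ (h0 U)]
    exact hc

end Divisibility

/-! ## Marks of finite sets with a group action -/

section Marks

open OClass Finset

variable {H : Type*} [Group H] [TopologicalSpace H] [IsTopologicalGroup H] [CompactSpace H]

/-- Decomposition into orbits: the marks of a finite `H`-set form a sum of columns of `ζ^1`. -/
theorem card_fixedPoints_eq_sum {X : Type*} [MulAction H X] [Finite X]
    [Fintype (MulAction.orbitRel.Quotient H X)]
    (hX : ∀ x : X, IsOpen (MulAction.stabilizer H x : Set H)) (Z : OpenSubgroup H) :
    Nat.card (MulAction.fixedPoints Z X) =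
      ∑ ω : MulAction.orbitRel.Quotient H X,
        fixCard Z ⟨MulAction.stabilizer H ω.out, hX ω.out⟩ := by
  have hiff : ∀ (x : X) (c : H ⧸ MulAction.stabilizer H x),
      c ∈ MulAction.fixedPoints Z (H ⧸ MulAction.stabilizer H x) ↔
        MulAction.ofQuotientStabilizer H x c ∈ MulAction.fixedPoints Z X := by
    intro x c
    rw [MulAction.mem_fixedPoints, MulAction.mem_fixedPoints]
    refine forall_congr' fun z => ?_
    have h1 : MulAction.ofQuotientStabilizer H x ((z : H) • c) =
        (z : H) • MulAction.ofQuotientStabilizer H x c :=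
      MulAction.ofQuotientStabilizer_smul H x z c
    change (z : H) • c = c ↔ (z : H) • MulAction.ofQuotientStabilizer H x c = _
    rw [← h1]
    exact (MulAction.injective_ofQuotientStabilizer H x).eq_iff.symm
  let Φ : (Σ ω : MulAction.orbitRel.Quotient H X,
      MulAction.fixedPoints Z (H ⧸ MulAction.stabilizer H ω.out)) → MulAction.fixedPoints Z X :=
    fun p => ⟨MulAction.ofQuotientStabilizer H p.1.out p.2.1, (hiff _ _).1 p.2.2⟩
  have hmk : ∀ (ω : MulAction.orbitRel.Quotient H X) (c : H ⧸ MulAction.stabilizer H ω.out),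
      (Quotient.mk _ (MulAction.ofQuotientStabilizer H ω.out c) :
        MulAction.orbitRel.Quotient H X) = ω := by
    intro ω c
    conv_rhs => rw [← Quotient.out_eq' ω]
    exact Quotient.sound (MulAction.ofQuotientStabilizer_mem_orbit H ω.out c)
  have hΦ : Function.Bijective Φ := by
    constructor
    · rintro ⟨ω, c, hc⟩ ⟨ω', c', hc'⟩ h
      have h1 : MulAction.ofQuotientStabilizer H ω.out c =
        MulAction.ofQuotientStabilizer H ω'.out c' := congrArg Subtype.val h
      have h2 : ω = ω' := by rw [← hmk ω c, ← hmk ω' c', h1]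
      subst h2
      have h3 := MulAction.injective_ofQuotientStabilizer H _ h1
      subst h3
      rfl
    · rintro ⟨x, hx⟩
      let ω : MulAction.orbitRel.Quotient H X := Quotient.mk _ x
      obtain ⟨h, hh⟩ : x ∈ MulAction.orbit H ω.out :=
        Quotient.exact (Quotient.out_eq' ω).symm
      have h2 : MulAction.ofQuotientStabilizer H ω.out (QuotientGroup.mk h) = x := hh
      exact ⟨⟨ω, QuotientGroup.mk h, (hiff _ _).2 (by rw [h2]; exact hx)⟩, Subtype.ext h2⟩
  have hf : ∀ ω : MulAction.orbitRel.Quotient H X,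
      Finite (MulAction.fixedPoints Z (H ⧸ MulAction.stabilizer H ω.out)) := fun ω =>
    Finite.of_injective (fun c => (Φ ⟨ω, c⟩).1) fun a b hab =>
      Subtype.ext (MulAction.injective_ofQuotientStabilizer H _ hab)
  rw [← Nat.card_congr (Equiv.ofBijective Φ hΦ), Nat.card_sigma]
  rfl

/-- The coordinates of the vector of marks of a finite `H`-set are integers. -/
theorem exists_int_coord_marks {X : Type*} [MulAction H X] [Finite X]
    (hX : ∀ x : X, IsOpen (MulAction.stabilizer H x : Set H)) (U : OpenSubgroup H)
    (a : OClass H → ℚ)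
    (ha : ∀ Z, U ≤ Z → a (OClass.mk Z) = Nat.card (MulAction.fixedPoints Z X)) :
    ∃ n : ℤ, coord 1 a (OClass.mk U) = n := by
  classical
  have := Fintype.ofFinite (MulAction.orbitRel.Quotient H X)
  have h : coord 1 a (OClass.mk U) = coord 1 (fun Z => ∑ ω : MulAction.orbitRel.Quotient H X,
      (zetaInt 1 Z (OClass.mk ⟨MulAction.stabilizer H ω.out, hX ω.out⟩) : ℚ)) (OClass.mk U) := by
    refine coord_congr fun Z hZ => ?_
    obtain ⟨Z, hUZ, rfl⟩ := exists_rep_of_prec hZ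
    rw [ha Z hUZ, card_fixedPoints_eq_sum hX]
    simp [zetaInt, fix_mk]
  rw [h, coord_sum]
  simp only [coord_zetaInt]
  refine ⟨∑ ω : MulAction.orbitRel.Quotient H X,
    if OClass.mk ⟨MulAction.stabilizer H ω.out, hX ω.out⟩ = OClass.mk U then 1 else 0, ?_⟩
  push_cast
  rfl

theorem stabilizer_mk (S : OpenSubgroup H) (g : H) :
    MulAction.stabilizer H (g : H ⧸ (S : Subgroup H)) = (conjOpen g S : Subgroup H) := by
  ext h
  rw [MulAction.mem_stabilizer_iff]
  change ((h * g : H) : H ⧸ (S : Subgroup H)) = g ↔ h ∈ conjOpen g S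
  rw [eq_comm, QuotientGroup.eq, mem_conjOpen, mul_assoc]
  rfl

theorem isOpen_stabilizer_quotient (S : OpenSubgroup H) (c : H ⧸ (S : Subgroup H)) :
    IsOpen (MulAction.stabilizer H c : Set H) := by
  induction c using QuotientGroup.induction_on with
  | H g =>
    rw [stabilizer_mk]
    exact (conjOpen g S).isOpen

theorem exists_int_coord_mul (S T U : OClass H) :
    ∃ n : ℤ, coord 1 (fun Z => (zetaInt 1 Z S : ℚ) * zetaInt 1 Z T) U = n := by
  induction U using OClass.ind with
  | h U =>
    induction S using OClass.ind with
    | h S =>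
      induction T using OClass.ind with
      | h T =>
        refine exists_int_coord_marks
          (X := (H ⧸ (S : Subgroup H)) × (H ⧸ (T : Subgroup H))) ?_ U _ ?_
        · rintro ⟨x, y⟩
          have : MulAction.stabilizer H (x, y) =
              MulAction.stabilizer H x ⊓ MulAction.stabilizer H y := by
            ext h
            simp [MulAction.mem_stabilizer_iff, Prod.ext_iff]
          rw [this]
          exact (isOpen_stabilizer_quotient S x).inter (isOpen_stabilizer_quotient T y)
        · intro Z _
          have : Nat.card (MulAction.fixedPoints Z
              ((H ⧸ (S : Subgroup H)) × (H ⧸ (T : Subgroup H)))) = fixCard Z S * fixCard Z T := by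
            rw [fixCard, fixCard, ← Nat.card_prod]
            refine Nat.card_congr (Equiv.trans (Equiv.subtypeEquivRight fun p => ?_)
              (Equiv.Set.prod _ _))
            rw [Set.mem_prod, MulAction.mem_fixedPoints, MulAction.mem_fixedPoints,
              MulAction.mem_fixedPoints, ← forall_and]
            exact forall_congr' fun z => Prod.ext_iff
          rw [this]
          simp [zetaInt, fix_mk]

theorem exists_int_coord_res {K : Type*} [Group K] [TopologicalSpace K] [IsTopologicalGroup K]
    [CompactSpace K] (f : OpenEmb H K) (S : OClass K) (U : OClass H) :
    ∃ n : ℤ, coord 1 (fun Z => (zetaInt 1 (f.mapClass Z) S : ℚ)) U = n := by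
  induction U using OClass.ind with
  | h U =>
    induction S using OClass.ind with
    | h S =>
      let _ : MulAction H (K ⧸ (S : Subgroup K)) := MulAction.compHom _ f.hom
      refine exists_int_coord_marks (X := K ⧸ (S : Subgroup K)) ?_ U _ ?_
      · intro c
        have : (MulAction.stabilizer H c : Set H) = f.hom ⁻¹' MulAction.stabilizer K c := rfl
        rw [this]
        exact (isOpen_stabilizer_quotient S c).preimage f.isOpenEmbedding.continuous
      · intro Z _
        have : Nat.card (MulAction.fixedPoints Z (K ⧸ (S : Subgroup K))) =
            fixCard (f.mapOpen Z) S := by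
          refine Nat.card_congr (Equiv.subtypeEquivRight fun c => ?_)
          rw [MulAction.mem_fixedPoints, MulAction.mem_fixedPoints]
          constructor
          · rintro h ⟨_, z, hz, rfl⟩
            exact h ⟨z, hz⟩
          · rintro h ⟨z, hz⟩
            exact h ⟨f.hom z, z, hz, rfl⟩
        rw [this]
        simp [zetaInt, f.mapClass_mk, fix_mk]

theorem exists_open_normal_le (U : OpenSubgroup H) :
    ∃ N : OpenSubgroup H, (N : Subgroup H).Normal ∧ N ≤ U := by
  have : (U : Subgroup H).FiniteIndex := ⟨Subgroup.index_ne_zero_of_finite⟩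
  exact ⟨⟨(U : Subgroup H).normalCore, Subgroup.isOpen_of_isClosed_of_finiteIndex _
    (Subgroup.normalCore_isClosed _ U.isClosed)⟩, Subgroup.normalCore_normal _,
    Subgroup.normalCore_le _⟩

/-- For `N` open normal in `U`, the `H`-set of functions `H/N → Fin n` has `n^(H:Z)` fixed points
under each `Z` containing `N`. The set depends on `U`, which is harmless because the coordinate at
`U` only involves groups `Z` containing `U`. -/
theorem exists_int_coord_natCast_pow_index (n : ℕ) (U : OClass H) :
    ∃ z : ℤ, coord 1 (fun Z => (n : ℚ) ^ index Z) U = z := by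
  induction U using OClass.ind with
  | h U =>
    obtain ⟨N, hN, hNU⟩ := exists_open_normal_le U
    let _ : MulAction H (H ⧸ (N : Subgroup H) → Fin n) := arrowAction
    have hsmul : ∀ (h : H) (F : H ⧸ (N : Subgroup H) → Fin n) (g : H),
        (h • F) (g : H ⧸ (N : Subgroup H)) = F ((h⁻¹ * g : H) : H ⧸ (N : Subgroup H)) :=
      fun _ _ _ => rfl
    refine exists_int_coord_marks (X := H ⧸ (N : Subgroup H) → Fin n) ?_ U _ ?_
    · intro F
      refine Subgroup.isOpen_mono (H₁ := (N : Subgroup H)) (fun m hm => ?_) N.isOpen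
      rw [MulAction.mem_stabilizer_iff]
      funext c
      induction c using QuotientGroup.induction_on with
      | H g =>
        rw [hsmul]
        congr 1
        refine QuotientGroup.eq.2 ?_
        have := hN.conj_mem m hm g⁻¹
        simpa [mul_assoc] using this
    · intro Z hUZ
      have hNZ : N ≤ Z := hNU.trans hUZ
      have hiff : ∀ F : H ⧸ (N : Subgroup H) → Fin n,
          F ∈ MulAction.fixedPoints Z (H ⧸ (N : Subgroup H) → Fin n) ↔
            ∀ z ∈ Z, ∀ g : H, F ((z * g : H) : H ⧸ (N : Subgroup H)) = F (g : H) := by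
        intro F
        rw [MulAction.mem_fixedPoints]
        constructor
        · intro h z hz g
          have := congrFun (h ⟨z⁻¹, inv_mem hz⟩) (g : H ⧸ (N : Subgroup H))
          rw [← this]
          change _ = (z⁻¹ • F) _
          rw [hsmul, inv_inv]
        · rintro h ⟨z, hz⟩
          funext c
          induction c using QuotientGroup.induction_on with
          | H g => exact h z⁻¹ (inv_mem hz) g
      -- Fixed functions are constant on the cosets `Zg`; inversion turns these into the cosets
      -- `gZ`, and normality of `N` makes inversion well defined on `H/N`.
      let e : MulAction.fixedPoints Z (H ⧸ (N : Subgroup H) → Fin n) ≃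
          (H ⧸ (Z : Subgroup H) → Fin n) :=
        { toFun := fun F => Quotient.lift
            (fun g : H => F.1 ((g⁻¹ : H) : H ⧸ (N : Subgroup H))) (by
              intro a b hab
              have h1 : b⁻¹ * a ∈ Z := by
                have := inv_mem (QuotientGroup.leftRel_apply.1 hab)
                simpa using this
              have := (hiff F.1).1 F.2 _ h1 a⁻¹
              simpa using this.symm)
          invFun := fun F => ⟨Quotient.lift
            (fun g : H => F ((g⁻¹ : H) : H ⧸ (Z : Subgroup H))) (by
              intro a b hab
              refine congrArg F (QuotientGroup.eq.2 ?_)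
              have h1 := hN.conj_mem _ (QuotientGroup.leftRel_apply.1 hab) a
              have h2 := hNZ (inv_mem h1)
              simpa [mul_assoc] using h2), by
              rw [hiff]
              intro z hz g
              refine congrArg F (QuotientGroup.eq.2 ?_)
              simpa using hz⟩
          left_inv := by
            intro F
            apply Subtype.ext
            funext c
            induction c using QuotientGroup.induction_on with
            | H g => exact congrArg (fun x : H => F.1 x) (inv_inv g)
          right_inv := by
            intro F
            funext c
            induction c using QuotientGroup.induction_on with
            | H g => exact congrArg (fun x : H => F x) (inv_inv g) }
      rw [Nat.card_congr e, Nat.card_fun, Nat.card_eq_fintype_card, Fintype.card_fin, index_mk,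
        Subgroup.index]
      push_cast
      rfl

/-- The coordinate is a polynomial in `q` with integer values at natural numbers, hence at all
integers. -/
theorem exists_int_coord_intCast_pow_index (q : ℤ) (U : OClass H) :
    ∃ z : ℤ, coord 1 (fun Z => (q : ℚ) ^ index Z) U = z := by
  let F : Polynomial ℚ := ∑ Z ∈ below U, Polynomial.C (muRat 1 U Z) * Polynomial.X ^ index Z
  have hF : ∀ x : ℚ, F.eval x = coord 1 (fun Z => x ^ index Z) U := by
    intro x
    rw [Polynomial.eval_finsetSum, coord]
    exact sum_congr rfl fun Z _ => by simp
  obtain ⟨z, hz⟩ := forall_int_exists_eval_eq (F := F) (fun n => by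
    rw [hF]; exact exists_int_coord_natCast_pow_index n U) q
  exact ⟨z, (hF _).symm.trans hz⟩

theorem coord_pow_index_sub_one_mem {p : ℕ} [Fact p.Prime] {q : ℤ} (hq : ¬ (p : ℤ) ∣ q)
    (U : OClass H) : coord 1 (fun Z => (q : ℚ) ^ (index Z - 1)) U ∈ localIntegers p := by
  have hq0 : (q : ℚ) ≠ 0 := by
    rintro h
    have : q = 0 := by exact_mod_cast h
    exact hq (this ▸ dvd_zero _)
  have h : (fun Z : OClass H => (q : ℚ) ^ (index Z - 1)) =
      fun Z => (q : ℚ)⁻¹ * (q : ℚ) ^ index Z := by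
    funext Z
    obtain ⟨m, hm⟩ := Nat.exists_eq_succ_of_ne_zero (index_ne_zero Z)
    rw [hm, Nat.succ_sub_one, Nat.succ_eq_add_one, pow_succ]
    field_simp
  rw [h, coord_mul_left]
  obtain ⟨z, hz⟩ := exists_int_coord_intCast_pow_index q U
  rw [hz]
  exact mul_mem (inv_mem_localIntegers hq) (intCast_mem _ z)

/-- The column `V` of `ζ^q_H` is induced from the column of the whole group in `ζ^q_V`, whose
entries are `q^((V:Z)-1)`. Induction acts on coordinates for `q = 1` by summing over fibres, so
integrality for that one column suffices. -/
theorem coord_one_zetaInt_mem {p : ℕ} [Fact p.Prime] {q : ℤ} (hq : ¬ (p : ℤ) ∣ q)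
    (U V : OClass H) : coord 1 (fun Z => (zetaInt q Z V : ℚ)) U ∈ localIntegers p := by
  induction V using OClass.ind with
  | h V =>
    have hV : (subtypeEmb V).hom.range = (V : Subgroup H) := Subgroup.range_subtype _
    have htop : (subtypeEmb V).mapClass (OClass.mk ⊤) = OClass.mk V := by
      refine congrArg OClass.mk (OpenSubgroup.ext fun x => ?_)
      exact ⟨fun ⟨v, _, e⟩ => e ▸ v.2, fun hx => ⟨⟨x, hx⟩, trivial, rfl⟩⟩
    set α : OClass V → ℚ := coord 1 fun Z => (q : ℚ) ^ (index Z - 1) with hα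
    have h : (fun Z => (zetaInt q Z (OClass.mk V) : ℚ)) =
        ghostLin 1 ((subtypeEmb V).indLin α) := by
      funext Z
      induction Z using OClass.ind with
      | h Z =>
        have hr : ∀ c : MulAction.fixedPoints Z (H ⧸ (V : Subgroup H)),
          ((c.1.out : H) : H ⧸ (V : Subgroup H)) = c.1 := fun c => Quotient.out_eq' c.1
        rw [(subtypeEmb V).ghostLin_indLin hV 1 Z (fun c => c.1.out) hr, ← htop,
          (subtypeEmb V).zetaInt_mapClass hV q Z (fun c => c.1.out) hr]
        rw [Int.cast_sum]
        refine sum_congr rfl fun c _ => ?_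
        rw [hα, ghostLin_coord, zetaInt, fix_top, rel_top]
        simp
    rw [h, coord_ghostLin, OpenEmb.indLin]
    exact sum_mem fun S _ => coord_pow_index_sub_one_mem hq S

/-- The coordinates for `q = 1` arise from those for `q` by the matrix `μ^1 ζ^q`, which is
unitriangular and `p`-integral, hence can be inverted over the local ring. -/
theorem coord_mem_of_coord_one_mem {p : ℕ} [Fact p.Prime] {q : ℤ} (hq : ¬ (p : ℤ) ∣ q)
    {a : OClass H → ℚ} (ha : ∀ U, coord 1 a U ∈ localIntegers p) (U : OClass H) :
    coord q a U ∈ localIntegers p := by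
  refine mem_of_triangular _ (fun U W => coord 1 (fun Z => (zetaInt q Z W : ℚ)) U) _ (fun U => ?_)
    (fun U W _ => coord_one_zetaInt_mem hq U W) (fun U => ?_) U
  · classical
    have h := coord_zetaInt 1 U U
    rw [if_pos rfl] at h
    rw [← h]
    refine coord_congr fun Z hZ => ?_
    -- The diagonal entry is `1` because only `Z = U` contributes, and there `ζ^q` and `ζ^1` agree.
    by_cases h' : Prec U Z
    · rw [eq_of_prec_of_index_eq h' (le_antisymm (index_le hZ) (index_le h')), zetaInt_self,
        zetaInt_self]
    · rw [zetaInt_eq_zero h', zetaInt_eq_zero h']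
  · have h : coord 1 a U = coord 1 (fun Z => ∑ W ∈ below U, coord q a W * zetaInt q Z W) U := by
      refine coord_congr fun Z hZ => ?_
      rw [← ghostLin_coord q a Z, ghostLin_eq_sum (below_subset hZ)]
      exact sum_congr rfl fun W _ => mul_comm _ _
    rw [coord_sum] at h
    simp only [coord_mul_left] at h
    simp only [mul_comm _ (coord q a _)]
    rw [← h]
    exact ha U

/-- By bilinearity this reduces to two columns of `ζ^1`, whose product is the vector of marks of
`(H/S) × (H/T)`. -/
theorem coord_one_mul_mem {R : Subring ℚ} {a b : OClass H → ℚ} (ha : ∀ U, coord 1 a U ∈ R)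
    (hb : ∀ U, coord 1 b U ∈ R) (U : OClass H) : coord 1 (fun Z => a Z * b Z) U ∈ R := by
  have h : coord 1 (fun Z => a Z * b Z) U = coord 1 (fun Z => ∑ S ∈ below U, ∑ T ∈ below U,
      (coord 1 a S * coord 1 b T) * ((zetaInt 1 Z S : ℚ) * zetaInt 1 Z T)) U := by
    refine coord_congr fun Z hZ => ?_
    rw [← ghostLin_coord 1 a Z, ← ghostLin_coord 1 b Z, ghostLin_eq_sum (below_subset hZ),
      ghostLin_eq_sum (below_subset hZ), sum_mul_sum]
    refine sum_congr rfl fun S _ => sum_congr rfl fun T _ => ?_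
    ring
  rw [h]
  simp only [coord_sum, coord_mul_left]
  refine sum_mem fun S _ => sum_mem fun T _ => mul_mem (mul_mem (ha S) (hb T)) ?_
  obtain ⟨n, hn⟩ := exists_int_coord_mul S T U
  rw [hn]
  exact intCast_mem R n

variable {K : Type*} [Group K] [TopologicalSpace K] [IsTopologicalGroup K] [CompactSpace K]

theorem coord_one_res_mem {R : Subring ℚ} (f : OpenEmb H K) {a : OClass K → ℚ}
    (ha : ∀ U, coord 1 a U ∈ R) (U : OClass H) : coord 1 (fun Z => a (f.mapClass Z)) U ∈ R := by
  have h : coord 1 (fun Z => a (f.mapClass Z)) U = coord 1 (fun Z => ∑ S ∈ below (f.mapClass U),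
      coord 1 a S * (zetaInt 1 (f.mapClass Z) S : ℚ)) U := by
    refine coord_congr fun Z hZ => ?_
    rw [← ghostLin_coord 1 a (f.mapClass Z), ghostLin_eq_sum (below_subset (f.prec_mapClass hZ))]
    exact sum_congr rfl fun S _ => mul_comm _ _
  rw [h]
  simp only [coord_sum, coord_mul_left]
  refine sum_mem fun S _ => mul_mem (ha S) ?_
  obtain ⟨n, hn⟩ := exists_int_coord_res f S U
  rw [hn]
  exact intCast_mem R n

/-- The structure constants of the multiplication are integers. -/
theorem isIntegralAt_structPoly (q : ℤ) (U V W : OClass H) :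
    IsIntegralAt (structPoly U V W) q := by
  rw [IsIntegralAt, eval_structPoly]
  refine exists_int_of_forall_mem_localIntegers fun p _ => ?_
  by_cases hq : (p : ℤ) ∣ q
  · refine coord_mem_of_dvd hq (fun Z => ?_) U
    have key : ∀ V : OClass H, ∃ c ∈ localIntegers p, (zetaInt q Z V : ℚ) = c * fix Z Z := by
      intro V
      by_cases h : Prec V Z
      · obtain ⟨c, hc, e⟩ := exists_mem_localIntegers_mul (rel_pos h) hq (fix_dvd_fix_mul_rel Z V)
        exact ⟨c, hc, by rw [← e, zetaInt]; push_cast; rfl⟩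
      · exact ⟨0, zero_mem _, by rw [zetaInt_eq_zero h]; simp⟩
    obtain ⟨c, hc, e⟩ := key V
    -- Divisibility of one factor by the diagonal entry is enough.
    exact ⟨c * zetaInt q Z W, mul_mem hc (intCast_mem _ _), by rw [e]; ring⟩
  · exact coord_mem_of_coord_one_mem hq (coord_one_mul_mem
      (fun U => coord_one_zetaInt_mem hq U V) (fun U => coord_one_zetaInt_mem hq U W)) U

/-- The entries of the matrix of `q`-restriction are integers. -/
theorem isIntegralAt_resPoly (q : ℤ) (f : OpenEmb H K) (V : OClass H) (W : OClass K) :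
    IsIntegralAt (resPoly f V W) q := by
  rw [IsIntegralAt, eval_resPoly]
  refine exists_int_of_forall_mem_localIntegers fun p _ => ?_
  by_cases hq : (p : ℤ) ∣ q
  · refine coord_mem_of_dvd hq (fun Z => ?_) V
    by_cases h : Prec W (f.mapClass Z)
    · obtain ⟨c, hc, e⟩ := exists_mem_localIntegers_mul (rel_pos h) hq (fix_self_dvd f Z W)
      exact ⟨c, hc, by rw [← e, zetaInt]; push_cast; rfl⟩
    · exact ⟨0, zero_mem _, by rw [zetaInt_eq_zero h]; simp⟩
  · exact coord_mem_of_coord_one_mem hq (coord_one_res_mem f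
      (fun U => coord_one_zetaInt_mem hq U W)) V

end Marks

/-! ## Induction and restriction of necklace rings -/

section InductionRestriction

open OClass Finset

variable {H K : Type*} [Group H] [TopologicalSpace H] [IsTopologicalGroup H] [CompactSpace H]
  [Group K] [TopologicalSpace K] [IsTopologicalGroup K] [CompactSpace K]

theorem cast_intEval {P : Polynomial ℚ} {q : ℤ} (h : IsIntegralAt P q) :
    (intEval P q : ℚ) = P.eval (q : ℚ) := by
  obtain ⟨z, hz⟩ := h
  rw [intEval, hz, Int.floor_intCast]

/-- The integer `P^U_{V,W}(q)`. -/
noncomputable def structInt (q : ℤ) (U V W : OClass H) : ℤ := intEval (structPoly U V W) q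

/-- The integer `Q_{V,W}(q)`. -/
noncomputable def resInt (q : ℤ) (f : OpenEmb H K) (V : OClass H) (W : OClass K) : ℤ :=
  intEval (resPoly f V W) q

theorem cast_structInt (q : ℤ) (U V W : OClass H) :
    (structInt q U V W : ℚ) = coord q (fun Z => (zetaInt q Z V : ℚ) * zetaInt q Z W) U := by
  rw [structInt, cast_intEval (isIntegralAt_structPoly q U V W), eval_structPoly]

theorem cast_resInt (q : ℤ) (f : OpenEmb H K) (V : OClass H) (W : OClass K) :
    (resInt q f V W : ℚ) = coord q (fun S => (zetaInt q (f.mapClass S) W : ℚ)) V := by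
  rw [resInt, cast_intEval (isIntegralAt_resPoly q f V W), eval_resPoly]

theorem structInt_eq_zero_left {q : ℤ} {U V : OClass H} (h : ¬ Prec V U) (W : OClass H) :
    structInt q U V W = 0 := by
  have : (structInt q U V W : ℚ) = 0 := by
    rw [cast_structInt, ← eval_structPoly, eval_structPoly_eq_zero q fun h' => h h'.1]
  exact_mod_cast this

theorem structInt_eq_zero_right {q : ℤ} {U W : OClass H} (V : OClass H) (h : ¬ Prec W U) :
    structInt q U V W = 0 := by
  have : (structInt q U V W : ℚ) = 0 := by
    rw [cast_structInt, ← eval_structPoly, eval_structPoly_eq_zero q fun h' => h h'.2]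
  exact_mod_cast this

theorem resInt_eq_zero {q : ℤ} {f : OpenEmb H K} {V : OClass H} {W : OClass K}
    (h : ¬ Prec W (f.mapClass V)) : resInt q f V W = 0 := by
  have : (resInt q f V W : ℚ) = 0 := by
    rw [cast_resInt, coord]
    refine sum_eq_zero fun Z hZ => ?_
    rw [zetaInt_eq_zero fun h' => h (prec_trans h' (f.prec_mapClass (mem_below.1 hZ)))]
    simp
  exact_mod_cast this

theorem ghostLin_structInt (q : ℤ) (V W Z : OClass H) :
    ghostLin q (fun U => (structInt q U V W : ℚ)) Z = zetaInt q Z V * zetaInt q Z W := by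
  simp only [cast_structInt]
  exact ghostLin_coord q _ Z

theorem ghostLin_resInt (q : ℤ) (f : OpenEmb H K) (W : OClass K) (Z : OClass H) :
    ghostLin q (fun V => (resInt q f V W : ℚ)) Z = zetaInt q (f.mapClass Z) W := by
  simp only [cast_resInt]
  exact ghostLin_coord q _ Z

theorem resInt_top (q : ℤ) (f : OpenEmb H K) (W : OClass K) :
    resInt q f (OClass.mk ⊤) W = zetaInt q (f.mapClass (OClass.mk ⊤)) W := by
  have h := ghostLin_resInt q f W (OClass.mk ⊤)
  rw [ghostLin, below_top, sum_singleton, zetaInt_self, fix_top] at h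
  simpa using h

theorem range_eq_mapOpen_top (f : OpenEmb H K) : f.hom.range = (f.mapOpen ⊤ : Subgroup K) :=
  MonoidHom.range_eq_map f.hom

/-- Frobenius reciprocity for the structure constants. -/
theorem structInt_mapClass (q : ℤ) (f : OpenEmb H K) (V : OClass H) (B W : OClass K) :
    structInt q W (f.mapClass V) B =
      ∑ S ∈ f.fiber W, ∑ T ∈ below S, structInt q S V T * resInt q f T B := by
  have key : (structInt q W (f.mapClass V) B : ℚ) =
      f.indLin (fun S => ∑ T ∈ below S, (structInt q S V T : ℚ) * resInt q f T B) W := by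
    refine ghostLin_injective (q := q) (h := fun W => (structInt q W (f.mapClass V) B : ℚ))
      (fun Z => ?_) W
    induction Z using OClass.ind with
    | h Z =>
      have hr : ∀ c : MulAction.fixedPoints Z (K ⧸ (f.mapOpen ⊤ : Subgroup K)),
        ((c.1.out : K) : K ⧸ (f.mapOpen ⊤ : Subgroup K)) = c.1 := fun c => Quotient.out_eq' c.1
      rw [ghostLin_structInt, f.ghostLin_indLin (range_eq_mapOpen_top f) q Z (fun c => c.1.out) hr,
        f.zetaInt_mapClass (range_eq_mapOpen_top f) q Z (fun c => c.1.out) hr, Int.cast_sum,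
        sum_mul]
      refine sum_congr rfl fun c _ => ?_
      have hle : Z ≤ conjOpen c.1.out (f.mapOpen ⊤) := by
        rw [← mk_mem_fixedPoints_iff_le, hr]
        exact c.2
      have hY := f.mapClass_pull (range_eq_mapOpen_top f) hle
      set Y := OClass.mk (f.pull c.1.out Z)
      -- As `[f(Y)] = [Z]`, the factor `ζ^q([Z], B)` is the ghost component at `Y` of the restricted
      -- column; both sides become the product of two ghost components at `Y`.
      rw [← hY, ← ghostLin_resInt, ghostLin, mul_sum]
      have h1 : ∀ S ∈ below Y, (zetaInt q Y S : ℚ) *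
          ∑ T ∈ below S, (structInt q S V T : ℚ) * resInt q f T B =
          ∑ T ∈ below Y, resInt q f T B * (zetaInt q Y S * structInt q S V T : ℚ) := by
        intro S hS
        rw [mul_sum]
        rw [sum_subset (below_subset (mem_below.1 hS))]
        · exact sum_congr rfl fun T _ => by ring
        · intro T _ hT
          rw [structInt_eq_zero_right V fun h => hT (mem_below.2 h)]
          simp
      rw [ghostLin, sum_congr rfl h1, sum_comm]
      refine sum_congr rfl fun T _ => ?_
      rw [← mul_sum]
      have h2 := ghostLin_structInt q V T Y
      rw [ghostLin] at h2
      rw [h2]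
      ring
  rw [OpenEmb.indLin] at key
  exact_mod_cast key

variable {A : Type*} [CommRing A] [SpecialLambdaRing A] {q : ℤ}

theorem nr_mul_apply (x y : Nr q H A) (U : OClass H) :
    (x * y) U = ∑ V ∈ below U, ∑ W ∈ below U,
      (structInt q U V W : A) * (adams (rel V U) (x V) * adams (rel W U) (y W)) := by
  rw [← sum_Below]
  refine sum_congr rfl fun V _ => ?_
  rw [← sum_Below]
  rfl

theorem ghost_apply (x : Nr q H A) (V : OClass H) :
    ghost x V = ∑ W ∈ below V, (zetaInt q V W : A) * adams (rel W V) (x W) := by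
  rw [← sum_Below V fun W => (zetaInt q V W : A) * adams (rel W V) (x W)]
  refine sum_congr rfl fun W _ => ?_
  simp [zetaInt]

theorem nrInd_apply (f : OpenEmb H K) (x : Nr q H A) (W : OClass K) :
    nrInd q f x W = ∑ V ∈ f.fiber W, x V := rfl

theorem adams_nrInd (n : ℕ) (f : OpenEmb H K) (x : Nr q H A) (W : OClass K) :
    adams n (nrInd q f x W) = ∑ V ∈ f.fiber W, adams n (x V) :=
  adams_sum n (f.fiber W) x

theorem qRes_apply (f : OpenEmb H K) (x : Nr q K A) (V : OClass H) :
    qRes q f x V = ∑ W ∈ below (f.mapClass V),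
      (resInt q f V W : A) * adams (rel W (f.mapClass V)) (x W) := by
  rw [← sum_Below]
  rfl

theorem nr_sum_apply {ι : Type*} (s : Finset ι) (F : ι → Nr q H A) (V : OClass H) :
    (∑ i ∈ s, F i) V = ∑ i ∈ s, F i V :=
  Finset.sum_apply V s (F : ι → OClass H → A)

/-- Both sides are integral combinations of the terms `t V B`, and their coefficients agree by
`structInt_mapClass`. -/
theorem frobenius_reciprocity (f : OpenEmb H K) (x : Nr q K A) (y : Nr q H A) :
    nrInd q f y * x = nrInd q f (y * qRes q f x) := by
  funext W
  rw [nr_mul_apply]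
  let t : OClass H → OClass K → A := fun V B =>
    adams (rel (f.mapClass V) W) (y V) * adams (rel B W) (x B)
  have hL : ∑ V ∈ below W, ∑ B ∈ below W, (structInt q W V B : A) *
      (adams (rel V W) (nrInd q f y V) * adams (rel B W) (x B)) =
      ∑ V ∈ f.preim (below W), ∑ B ∈ below W, (structInt q W (f.mapClass V) B : A) * t V B := by
    rw [← f.sum_sum_fiber (below W) fun C V => ∑ B ∈ below W, (structInt q W C B : A) *
      (adams (rel C W) (y V) * adams (rel B W) (x B))]
    refine sum_congr rfl fun C _ => ?_
    rw [sum_comm]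
    refine sum_congr rfl fun B _ => ?_
    rw [adams_nrInd, sum_mul, mul_sum]
  have hR : ∀ S ∈ f.fiber W, (y * qRes q f x) S = ∑ V ∈ f.preim (below W), ∑ B ∈ below W,
      ((∑ T ∈ below S, structInt q S V T * resInt q f T B : ℤ) : A) * t V B := by
    intro S hS
    have hSW := f.mem_fiber.1 hS
    have hsub : below S ⊆ f.preim (below W) := by
      intro V hV
      rw [f.mem_preim, mem_below, ← hSW]
      exact f.prec_mapClass (mem_below.1 hV)
    rw [nr_mul_apply]
    have h1 : ∀ V ∈ below S, ∑ T ∈ below S, (structInt q S V T : A) *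
        (adams (rel V S) (y V) * adams (rel T S) (qRes q f x T)) =
        ∑ B ∈ below W, ((∑ T ∈ below S, structInt q S V T * resInt q f T B : ℤ) : A) *
          t V B := by
      intro V _
      simp only [Int.cast_sum, sum_mul]
      rw [sum_comm]
      refine sum_congr rfl fun T hT => ?_
      have hTS := mem_below.1 hT
      have hTW : Prec (f.mapClass T) W := by
        rw [← hSW]
        exact f.prec_mapClass hTS
      rw [qRes_apply, adams_sum, mul_sum, mul_sum]
      have h2 : ∀ B ∈ below (f.mapClass T), (structInt q S V T : A) * (adams (rel V S) (y V) *
          adams (rel T S) (resInt q f T B * adams (rel B (f.mapClass T)) (x B))) =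
          ((structInt q S V T * resInt q f T B : ℤ) : A) * t V B := by
        intro B hB
        -- Since `(T:S) = (f(T):f(S))` and `[f(S)] = W`, the composite of the two Adams operations
        -- has exponent `(B:W)`, independent of `T`.
        rw [adams_intCast_mul, adams_adams _ _ (rel_pos hTS) (rel_pos (mem_below.1 hB)),
          ← f.rel_mapClass S T, ← f.rel_mapClass S V, hSW, rel_mul_rel (mem_below.1 hB) hTW]
        push_cast
        ring
      rw [sum_congr rfl h2]
      refine sum_subset (below_subset hTW) fun B _ hB => ?_
      rw [resInt_eq_zero fun h => hB (mem_below.2 h)]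
      simp
    rw [sum_congr rfl h1]
    refine sum_subset hsub fun V _ hV => sum_eq_zero fun B _ => ?_
    rw [sum_eq_zero fun T _ => ?_]
    · simp
    · rw [structInt_eq_zero_left fun h => hV (mem_below.2 h)]
      simp
  rw [hL, nrInd_apply, sum_congr rfl hR]
  conv_rhs => rw [sum_comm]
  refine sum_congr rfl fun V _ => ?_
  conv_rhs => rw [sum_comm]
  refine sum_congr rfl fun B _ => ?_
  rw [structInt_mapClass, Int.cast_sum, sum_mul]

theorem ghost_nrInd (f : OpenEmb H K) (x : Nr q H A) (Z : OClass K) :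
    ghost (nrInd q f x) Z = ∑ T ∈ f.preim (below Z),
      (zetaInt q Z (f.mapClass T) : A) * adams (rel (f.mapClass T) Z) (x T) := by
  rw [ghost_apply, ← f.sum_sum_fiber (below Z) fun W T =>
    (zetaInt q Z W : A) * adams (rel W Z) (x T)]
  refine sum_congr rfl fun W _ => ?_
  rw [adams_nrInd, mul_sum]

theorem ghost_top (x : Nr q H A) : ghost x (OClass.mk ⊤) = x (OClass.mk ⊤) := by
  rw [ghost_apply, below_top, sum_singleton, zetaInt_self, fix_top, rel_self, adams_one_left]
  simp

theorem qRes_nrInd_apply {L : Type*} [Group L] [TopologicalSpace L] [IsTopologicalGroup L]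
    [CompactSpace L] (f : OpenEmb L K) (g : OpenEmb H K) (x : Nr q H A) (S : OClass L) :
    qRes q f (nrInd q g x) S = ∑ T ∈ g.preim (below (f.mapClass S)),
      (resInt q f S (g.mapClass T) : A) *
        adams (rel (g.mapClass T) (f.mapClass S)) (x T) := by
  rw [qRes_apply, ← g.sum_sum_fiber (below (f.mapClass S)) fun W T =>
    (resInt q f S W : A) * adams (rel W (f.mapClass S)) (x T)]
  refine sum_congr rfl fun W _ => ?_
  rw [adams_nrInd, mul_sum]

end InductionRestriction

/-! ### Fixed cosets, double cosets and the Mackey formula -/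

section Mackey

open OClass Finset

variable {G : Type*} [Group G] [TopologicalSpace G] [IsTopologicalGroup G] [CompactSpace G]

theorem range_subtypeEmb (V : OpenSubgroup G) :
    (subtypeEmb V).hom.range = (V : Subgroup G) := Subgroup.range_subtype _

theorem mapOpen_conjEmb_top (U V : OpenSubgroup G) (g : G) (h : ∀ u ∈ U, g⁻¹ * u * g ∈ V) :
    (conjEmb U V g h).mapOpen ⊤ = (subtypeEmb V).pull g U := by
  ext v
  rw [OpenEmb.mem_mapOpen, OpenEmb.mem_pull]
  constructor
  · rintro ⟨u, _, rfl⟩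
    change g * (g⁻¹ * u * g) * g⁻¹ ∈ U
    simp [mul_assoc]
  · intro hv
    refine ⟨⟨_, hv⟩, trivial, Subtype.ext ?_⟩
    change g⁻¹ * (g * v * g⁻¹) * g = v
    simp [mul_assoc]

variable {A : Type*} [CommRing A] [SpecialLambdaRing A] {q : ℤ}

/-- At the class of the whole group `U` the ghost component is the coordinate itself, and the
entries of restriction are entries of `ζ^q` at `g⁻¹Ug`. The claim is then `zetaInt_mapClass`, with
equal Adams exponents on both sides. -/
theorem ghost_nrInd_eq_sum (U V : OpenSubgroup G)
    (r : MulAction.fixedPoints U (G ⧸ (V : Subgroup G)) → G)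
    (hr : ∀ c, (r c : G ⧸ (V : Subgroup G)) = c.1)
    (h : ∀ c, ∀ u ∈ U, (r c)⁻¹ * u * r c ∈ V) (x : Nr q V A) :
    ghost (nrInd q (subtypeEmb V) x) (OClass.mk U) =
      ∑ c, ghost (qRes q (conjEmb U V (r c) (h c)) x) (OClass.mk ⊤) := by
  rw [ghost_nrInd]
  have h1 : ∀ c, ghost (qRes q (conjEmb U V (r c) (h c)) x) (OClass.mk ⊤) =
      ∑ T ∈ (subtypeEmb V).preim (below (OClass.mk U)),
        (zetaInt q (OClass.mk ((subtypeEmb V).pull (r c) U)) T : A) *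
          adams (rel ((subtypeEmb V).mapClass T) (OClass.mk U)) (x T) := by
    intro c
    have hY := (subtypeEmb V).mapClass_pull (range_subtypeEmb V) (le_conjOpen_iff.2 (h c))
    rw [ghost_top, qRes_apply]
    simp only [resInt_top]
    rw [OpenEmb.mapClass_mk, mapOpen_conjEmb_top]
    set Y := OClass.mk ((subtypeEmb V).pull (r c) U)
    simp only [← hY, OpenEmb.rel_mapClass]
    refine sum_subset (fun T hT => ?_) fun T _ hT => ?_
    · rw [OpenEmb.mem_preim, mem_below]
      exact OpenEmb.prec_mapClass _ (mem_below.1 hT)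
    · rw [zetaInt_eq_zero fun h => hT (mem_below.2 h)]
      simp
  rw [sum_congr rfl fun c _ => h1 c, sum_comm]
  refine sum_congr rfl fun T _ => ?_
  rw [(subtypeEmb V).zetaInt_mapClass (range_subtypeEmb V) q U r hr, Int.cast_sum, sum_mul]

theorem mk_pull_eq_of_mk_eq (V Z : OpenSubgroup G) {k k' : G}
    (h : (k : G ⧸ (V : Subgroup G)) = k') :
    OClass.mk ((subtypeEmb V).pull k Z) = OClass.mk ((subtypeEmb V).pull k' Z) := by
  let v : V := ⟨k⁻¹ * k', QuotientGroup.eq.1 h⟩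
  refine (OClass.mk_conjOpen v⁻¹ _).symm.trans (congrArg OClass.mk (OpenSubgroup.ext fun x => ?_))
  rw [mem_conjOpen, OpenEmb.mem_pull, OpenEmb.mem_pull, inv_inv]
  change k * (k⁻¹ * k' * x * (k⁻¹ * k')⁻¹) * k⁻¹ ∈ Z ↔ k' * x * k'⁻¹ ∈ Z
  simp [mul_assoc]

/-- Both sides consist of the `v` in `V` with `(ug) v (ug)⁻¹` in `Z`. This matches the summands of
the two fixed point expansions in the Mackey formula. -/
theorem mapOpen_conjEmb_pull_inclEmb (U V : OpenSubgroup G) (g : G) (u : U) (Z : OpenSubgroup U) :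
    (conjEmb (U ⊓ conjOpen g V) V g (conj_mem_of_mem_inter U V g)).mapOpen
      ((inclEmb (U ⊓ conjOpen g V) U inf_le_left).pull u Z) =
    (subtypeEmb V).pull (u * g) ((subtypeEmb U).mapOpen Z) := by
  ext v
  rw [OpenEmb.mem_mapOpen, OpenEmb.mem_pull, OpenEmb.mem_mapOpen]
  constructor
  · rintro ⟨x, hx, rfl⟩
    refine ⟨_, (OpenEmb.mem_pull _).1 hx, ?_⟩
    change (u * x * (u : G)⁻¹ : G) = u * g * (g⁻¹ * x * g) * (u * g : G)⁻¹
    simp [mul_assoc]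
  · rintro ⟨z, hz, hzv⟩
    have hzv' : (z : G) = u * g * v * (u * g : G)⁻¹ := hzv
    have h1 : g * (v : G) * g⁻¹ = ((u⁻¹ * z * u : U) : G) := by
      simp [hzv', mul_assoc]
    have h2 : g * (v : G) * g⁻¹ ∈ U ⊓ conjOpen g V :=
      ⟨by rw [h1]; exact (u⁻¹ * z * u).2, mem_conjOpen.2 (by simp [mul_assoc])⟩
    refine ⟨⟨_, h2⟩, (OpenEmb.mem_pull _).2 ?_, Subtype.ext ?_⟩
    · convert hz using 1
      apply Subtype.ext
      change (u * (g * v * g⁻¹) * (u : G)⁻¹ : G) = z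
      rw [hzv']
      simp [mul_assoc]
    · change g⁻¹ * (g * v * g⁻¹) * g = v
      simp [mul_assoc]

/-- The two images in `G` are conjugate by `g`, so the Adams exponents computed in `V` and in `U`
agree. -/
theorem mapClass_conjEmb (U V : OpenSubgroup G) (g : G)
    (R : OClass (U ⊓ conjOpen g V : OpenSubgroup G)) :
    (subtypeEmb V).mapClass
      ((conjEmb (U ⊓ conjOpen g V) V g (conj_mem_of_mem_inter U V g)).mapClass R) =
    (subtypeEmb U).mapClass ((inclEmb (U ⊓ conjOpen g V) U inf_le_left).mapClass R) := by
  induction R using OClass.ind with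
  | h R =>
    simp only [OpenEmb.mapClass_mk]
    refine Eq.trans (congrArg OClass.mk ?_) (OClass.mk_conjOpen g⁻¹ _)
    ext x
    rw [mem_conjOpen, inv_inv]
    constructor
    · rintro ⟨_, ⟨y, hy, rfl⟩, rfl⟩
      refine ⟨_, ⟨y, hy, rfl⟩, ?_⟩
      change (y : G) = g * (g⁻¹ * y * g) * g⁻¹
      simp [mul_assoc]
    · rintro ⟨_, ⟨y, hy, rfl⟩, hx⟩
      refine ⟨_, ⟨y, hy, rfl⟩, ?_⟩
      change g⁻¹ * (y : G) * g = x
      have hx' : (y : G) = g * x * g⁻¹ := hx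
      rw [hx']
      simp [mul_assoc]

/-- The `Z`-fixed points of `G/V` sorted by double cosets. -/
theorem sum_fixedPoints_eq_sum_doubleCoset (U V : OpenSubgroup G) (Z : OpenSubgroup U)
    (r : DoubleCoset.Quotient ((U : Subgroup G) : Set G) ((V : Subgroup G) : Set G) → G)
    (hr : ∀ d, DoubleCoset.mk (U : Subgroup G) (V : Subgroup G) (r d) = d)
    {M : Type*} [AddCommMonoid M] (F : G → M)
    (hF : ∀ a b : G, (a : G ⧸ (V : Subgroup G)) = b → F a = F b) :
    ∑ c : MulAction.fixedPoints ((subtypeEmb U).mapOpen Z) (G ⧸ (V : Subgroup G)), F c.1.out =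
      ∑ d, ∑ e : MulAction.fixedPoints Z
        (U ⧸ ((inclEmb (U ⊓ conjOpen (r d) V) U inf_le_left).mapOpen ⊤ : Subgroup U)),
        F ((e.1.out : U) * r d) := by
  have hmem : ∀ d (u : U), u ∈ (inclEmb (U ⊓ conjOpen (r d) V) U inf_le_left).mapOpen ⊤ ↔
      (r d)⁻¹ * u * r d ∈ V := by
    intro d u
    rw [OpenEmb.mem_mapOpen]
    constructor
    · rintro ⟨x, _, rfl⟩
      exact mem_conjOpen.1 x.2.2
    · intro h
      exact ⟨⟨u, u.2, mem_conjOpen.2 h⟩, trivial, rfl⟩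
  have hfix : ∀ d (u : U), (((u : G) * r d : G) : G ⧸ (V : Subgroup G)) ∈
        MulAction.fixedPoints ((subtypeEmb U).mapOpen Z) (G ⧸ (V : Subgroup G)) ↔
      (u : U ⧸ ((inclEmb (U ⊓ conjOpen (r d) V) U inf_le_left).mapOpen ⊤ : Subgroup U)) ∈
        MulAction.fixedPoints Z _ := by
    intro d u
    rw [mk_mem_fixedPoints_iff, mk_mem_fixedPoints_iff]
    constructor
    · intro h z hz
      rw [hmem]
      have := h _ ⟨z, hz, rfl⟩
      change ((u : G) * r d)⁻¹ * (z : G) * (u * r d) ∈ V at this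
      change (r d)⁻¹ * ((u : G)⁻¹ * z * u) * r d ∈ V
      simpa [mul_assoc] using this
    · rintro h _ ⟨z, hz, rfl⟩
      have := (hmem d _).1 (h z hz)
      change (r d)⁻¹ * ((u : G)⁻¹ * z * u) * r d ∈ V at this
      change ((u : G) * r d)⁻¹ * (z : G) * (u * r d) ∈ V
      simpa [mul_assoc] using this
  have hout : ∀ {L : Type _} [Group L] (S : Subgroup L) (c : L ⧸ S), ((c.out : L) : L ⧸ S) = c :=
    fun S c => Quotient.out_eq' c
  -- The `U`-orbit of `r(d) V` in `G/V` is `U/(U ∩ r(d) V r(d)⁻¹)`, via the map sending the class of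
  -- `u` to `u r(d) V`.
  let Φ : (Σ d, MulAction.fixedPoints Z
      (U ⧸ ((inclEmb (U ⊓ conjOpen (r d) V) U inf_le_left).mapOpen ⊤ : Subgroup U))) →
      MulAction.fixedPoints ((subtypeEmb U).mapOpen Z) (G ⧸ (V : Subgroup G)) :=
    fun p => ⟨(((p.2.1.out : U) * r p.1 : G) : G ⧸ (V : Subgroup G)),
      (hfix p.1 p.2.1.out).2 (by rw [hout]; exact p.2.2)⟩
  have hΦ : Function.Bijective Φ := by
    constructor
    · rintro ⟨d, e, he⟩ ⟨d', e', he'⟩ h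
      have h1 : (((e.out : U) * r d : G) : G ⧸ (V : Subgroup G)) =
        (((e'.out : U) * r d' : G) : G ⧸ (V : Subgroup G)) := congrArg Subtype.val h
      have h2 := QuotientGroup.eq.1 h1
      have hd : d = d' := by
        rw [← hr d, ← hr d', DoubleCoset.eq]
        refine ⟨((e'.out : U) : G)⁻¹ * (e.out : U), mul_mem (inv_mem e'.out.2) e.out.2, _, h2, ?_⟩
        simp [mul_assoc]
      subst hd
      have h3 : e = e' := by
        rw [← hout _ e, ← hout _ e', QuotientGroup.eq]
        refine (hmem d _).2 ?_
        change (r d)⁻¹ * (((e.out : U) : G)⁻¹ * (e'.out : U)) * r d ∈ V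
        have h4 : ((e.out : U) * r d : G)⁻¹ * ((e'.out : U) * r d) ∈ V := h2
        simpa [mul_assoc] using h4
      subst h3
      rfl
    · rintro ⟨c, hc⟩
      induction c using QuotientGroup.induction_on with
      | H k =>
        obtain ⟨h, hh, v, hv, e⟩ := (DoubleCoset.eq (U : Subgroup G) (V : Subgroup G) k _).1
          (hr (DoubleCoset.mk (U : Subgroup G) (V : Subgroup G) k)).symm
        set d := DoubleCoset.mk (U : Subgroup G) (V : Subgroup G) k with hd
        let u : U := ⟨h⁻¹, inv_mem hh⟩
        let e' : U ⧸ ((inclEmb (U ⊓ conjOpen (r d) V) U inf_le_left).mapOpen ⊤ : Subgroup U) := u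
        have h1 : (u : G) * r d = k * v := by
          change h⁻¹ * r d = k * v
          rw [e]
          simp [mul_assoc]
        have h2 : (((u : G) * r d : G) : G ⧸ (V : Subgroup G)) = k := by
          rw [h1]
          refine (QuotientGroup.eq.2 ?_).symm
          simpa using hv
        have h3 : (((e'.out : U) * r d : G) : G ⧸ (V : Subgroup G)) = k := by
          rw [← h2]
          refine QuotientGroup.eq.2 ?_
          have h4 := (hmem d _).1 (QuotientGroup.eq.1 (show ((e'.out : U) : U ⧸
            ((inclEmb (U ⊓ conjOpen (r d) V) U inf_le_left).mapOpen ⊤ : Subgroup U)) = u from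
            hout _ e'))
          change (r d)⁻¹ * (((e'.out : U) : G)⁻¹ * (u : G)) * r d ∈ V at h4
          change ((e'.out : U) * r d : G)⁻¹ * (u * r d) ∈ V
          simpa [mul_assoc] using h4
        refine ⟨⟨d, e', (hfix d u).1 ?_⟩, Subtype.ext h3⟩
        rw [h2]
        exact hc
  rw [← Fintype.sum_sigma']
  refine (Fintype.sum_bijective Φ hΦ _ _ fun p => hF _ _ ?_).symm
  exact (hout _ (Φ p).1).symm

/-- The Mackey formula for matrix entries: the ghost component at `Z` on the left is a sum over
`Z`-fixed cosets in `G/V`, and sorting them by double cosets gives the ghost components of the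
vectors induced from `U ∩ gVg⁻¹`. -/
theorem resInt_mapClass (U V : OpenSubgroup G)
    (r : DoubleCoset.Quotient ((U : Subgroup G) : Set G) ((V : Subgroup G) : Set G) → G)
    (hr : ∀ d, DoubleCoset.mk (U : Subgroup G) (V : Subgroup G) (r d) = d)
    (q : ℤ) (T : OClass V) (S : OClass U) :
    resInt q (subtypeEmb U) S ((subtypeEmb V).mapClass T) =
      ∑ d, ∑ R ∈ (inclEmb (U ⊓ conjOpen (r d) V) U inf_le_left).fiber S,
        resInt q (conjEmb (U ⊓ conjOpen (r d) V) V (r d) (conj_mem_of_mem_inter U V (r d))) R T := by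
  have key : (resInt q (subtypeEmb U) S ((subtypeEmb V).mapClass T) : ℚ) =
      ∑ d, (inclEmb (U ⊓ conjOpen (r d) V) U inf_le_left).indLin (fun R => (resInt q
        (conjEmb (U ⊓ conjOpen (r d) V) V (r d) (conj_mem_of_mem_inter U V (r d))) R T : ℚ)) S := by
    refine ghostLin_injective (q := q)
      (h := fun S => (resInt q (subtypeEmb U) S ((subtypeEmb V).mapClass T) : ℚ))
      (h' := fun S => ∑ d, (inclEmb (U ⊓ conjOpen (r d) V) U inf_le_left).indLin (fun R => (resInt q
        (conjEmb (U ⊓ conjOpen (r d) V) V (r d) (conj_mem_of_mem_inter U V (r d))) R T : ℚ)) S)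
      (fun Z => ?_) S
    induction Z using OClass.ind with
    | h Z =>
      have hsum : ∀ (h : DoubleCoset.Quotient ((U : Subgroup G) : Set G) ((V : Subgroup G) : Set G)
          → OClass U → ℚ), ghostLin q (fun S => ∑ d, h d S) (OClass.mk Z) =
            ∑ d, ghostLin q (h d) (OClass.mk Z) := by
        intro h
        simp only [ghostLin, mul_sum]
        exact sum_comm
      rw [ghostLin_resInt, hsum, OpenEmb.mapClass_mk,
        (subtypeEmb V).zetaInt_mapClass (range_subtypeEmb V) q _ (fun c => c.1.out)
          (fun c => Quotient.out_eq' c.1), Int.cast_sum,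
        sum_fixedPoints_eq_sum_doubleCoset U V Z r hr (fun k => (zetaInt q (OClass.mk
          ((subtypeEmb V).pull k ((subtypeEmb U).mapOpen Z))) T : ℚ))
          (fun a b hab => by rw [mk_pull_eq_of_mk_eq V _ hab])]
      refine sum_congr rfl fun d _ => ?_
      rw [OpenEmb.ghostLin_indLin _ (range_eq_mapOpen_top _) q Z (fun c => c.1.out)
          (fun c => Quotient.out_eq' c.1)]
      refine sum_congr rfl fun e _ => ?_
      rw [ghostLin_resInt, OpenEmb.mapClass_mk, mapOpen_conjEmb_pull_inclEmb]
  simp only [OpenEmb.indLin] at key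
  exact_mod_cast key

theorem mackey_formula (U V : OpenSubgroup G)
    (r : DoubleCoset.Quotient ((U : Subgroup G) : Set G) ((V : Subgroup G) : Set G) → G)
    (hr : ∀ d, DoubleCoset.mk (U : Subgroup G) (V : Subgroup G) (r d) = d) (x : Nr q V A) :
    qRes q (subtypeEmb U) (nrInd q (subtypeEmb V) x) =
      ∑ d, nrInd q (inclEmb (U ⊓ conjOpen (r d) V) U inf_le_left)
        (qRes q (conjEmb (U ⊓ conjOpen (r d) V) V (r d) (conj_mem_of_mem_inter U V (r d))) x) := by
  funext S
  rw [qRes_nrInd_apply, nr_sum_apply]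
  have h1 : ∀ d, nrInd q (inclEmb (U ⊓ conjOpen (r d) V) U inf_le_left)
      (qRes q (conjEmb (U ⊓ conjOpen (r d) V) V (r d) (conj_mem_of_mem_inter U V (r d))) x) S =
      ∑ T ∈ (subtypeEmb V).preim (below ((subtypeEmb U).mapClass S)),
        ((∑ R ∈ (inclEmb (U ⊓ conjOpen (r d) V) U inf_le_left).fiber S, resInt q
          (conjEmb (U ⊓ conjOpen (r d) V) V (r d) (conj_mem_of_mem_inter U V (r d))) R T : ℤ) : A) *
        adams (rel ((subtypeEmb V).mapClass T) ((subtypeEmb U).mapClass S)) (x T) := by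
    intro d
    rw [nrInd_apply]
    simp only [Int.cast_sum, sum_mul]
    rw [sum_comm]
    refine sum_congr rfl fun R hR => ?_
    have hY := mapClass_conjEmb U V (r d) R
    rw [(OpenEmb.mem_fiber _).1 hR] at hY
    rw [qRes_apply, ← hY]
    simp only [OpenEmb.rel_mapClass]
    refine sum_subset (fun T hT => ?_) fun T _ hT => ?_
    · rw [OpenEmb.mem_preim, mem_below]
      exact OpenEmb.prec_mapClass _ (mem_below.1 hT)
    · rw [resInt_eq_zero fun h => hT (mem_below.2 h)]
      simp
  rw [sum_congr rfl fun d _ => h1 d, sum_comm]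
  refine sum_congr rfl fun T _ => ?_
  rw [resInt_mapClass U V r hr, Int.cast_sum, sum_mul]

end Mackey

theorem mainTheorem10 {G : Type u} [Group G] [TopologicalSpace G] [IsTopologicalGroup G]
    [CompactSpace G] [TotallyDisconnectedSpace G]
    {A : Type v} [CommRing A] [SpecialLambdaRing A] (q : ℤ) :
    -- the structure constants of the multiplication and of `q`-restriction are integers
    ((∀ U V W : OClass G, IsIntegralAt (structPoly U V W) q) ∧
      (∀ (H : Type u) [Group H] [TopologicalSpace H] [IsTopologicalGroup H] [CompactSpace H]
        [TotallyDisconnectedSpace H] (f : OpenEmb H G) (V : OClass H) (W : OClass G),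
        IsIntegralAt (resPoly f V W) q)) ∧
    -- (a) Frobenius reciprocity
    (∀ (U : OpenSubgroup G) (x : Nr q G A) (y : Nr q U A),
      nrInd q (subtypeEmb U) y * x = nrInd q (subtypeEmb U) (y * qRes q (subtypeEmb U) x)) ∧
    -- (b) Mackey subgroup theorem, for every choice `r` of double coset representatives
    (∀ (U V : OpenSubgroup G)
      (r : DoubleCoset.Quotient ((U : Subgroup G) : Set G) ((V : Subgroup G) : Set G) → G)
      (_ : ∀ d, DoubleCoset.mk (U : Subgroup G) (V : Subgroup G) (r d) = d) (x : Nr q V A),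
      qRes q (subtypeEmb U) (nrInd q (subtypeEmb V) x) =
        ∑ d, nrInd q (inclEmb (U ⊓ conjOpen (r d) V) U inf_le_left)
          (qRes q (conjEmb (U ⊓ conjOpen (r d) V) V (r d) (conj_mem_of_mem_inter U V (r d))) x)) ∧
    -- (c), for every choice `r` of coset representatives
    (∀ (U V : OpenSubgroup G)
      (r : MulAction.fixedPoints U (G ⧸ (V : Subgroup G)) → G)
      (hr : ∀ c, (r c : G ⧸ (V : Subgroup G)) = c.1) (x : Nr q V A),
      ghost (nrInd q (subtypeEmb V) x) (OClass.mk U) =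
        ∑ c, ghost (qRes q (conjEmb U V (r c)
          (conj_mem_of_fixed U V (r c) ((hr c).symm ▸ c.2))) x) (OClass.mk ⊤)) := by
  exact ⟨⟨isIntegralAt_structPoly q, fun H _ _ _ _ _ f V W => isIntegralAt_resPoly q f V W⟩,
    fun U x y => frobenius_reciprocity (subtypeEmb U) x y,
    fun U V r hr x => mackey_formula U V r hr x,
    fun U V r hr x => ghost_nrInd_eq_sum U V r hr _ x⟩
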